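/- **Theorem.** Let $\mathbb K\in\{\mathbb R,\mathbb C\}$, let $X=(\Omega,\Sigma,\mu)$ be a complete $\sigma$-finite measure space, and let $\varphi\colon X\to X$ be an automorphism, i.e. a measurable measure-preserving map that has a measurable measure-preserving inverse $\varphi^{-1}$ up to null sets. Write $T_\varphi f = f\circ\varphi^{-1}$ for $f$ in $L^p(X)$. An *$L^1(X)$-normed module* is a Banach space $\Gamma$ over $\mathbb K$ that is a unitary module over the algebra $L^\infty(X)$ with $\|fs\|\le\|f\|\,\|s\|$, together with a map $|\cdot|\colon\Gamma\to L^1(X)_+$ such that $\||s|\|=\|s\|$, $|fs|=|f|\,|s|$ and $|s+t|\le|s|+|t|$ for all $f\in L^\infty(X)$ and $s,t\in\Gamma$. **(1)** Let $\Gamma,\Lambda$ be $L^1(X)$-normed modules and $\mathcal T\colon\Gamma\to\Lambda$ a bounded linear operator. The following are equivalent: * (a) $\mathcal T(fs)=T_\varphi f\cdot\mathcal Ts$ for all $f\in L^\infty(X)$ and $s\in\Gamma$; * (b) $|\mathcal Ts|\le\|\mathcal T\|\cdot T_\varphi|s|$ for all $s\in\Gamma$; * (c) there is $m>0$ with $|\mathcal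 Ts|\le m\cdot T_\varphi|s|$ for all $s\in\Gamma$. A *measurable Banach bundle* $E$ over $X$ consists of Banach spaces $E_x$ ($x\in\Omega$) and a linear space $\mathcal M_E$ of sections $s\colon x\mapsto s(x)\in E_x$ such that $\mathcal M_E$ is closed under multiplication by measurable scalar functions and under almost everywhere limits of sequences, and $x\mapsto\|s(x)\|$ is measurable for each $s\in\mathcal M_E$. It is *separable* if there are $s_n\in\mathcal M_E$ ($n\in\mathbb N$) such that $\operatorname{lin}\{s_n(x): n\in\mathbb N\}$ is dense in $E_x$ for almost every $x$. For $p\in\{1,\infty\}$, $\Gamma^p(E)$ is the space of all $s\in\mathcal M_E$ such that $|s|\colon x\mapsto\|s(x)\|$ is in $L^p(X)$, modulo almost everywhere equality, with norm $\||s|\|_p$; $\Gamma^1(E)$ is an $L^1(X)$-normed module. A *morphism* $\Phi\colon E\to F$ over $\varphi$ is an almost everywhere equivalence class of maps $\Phi\colon\bigsqcup_x E_x\to\bigsqcup_x F_x$ such that: for almost every $x$, $\Phi$ maps $E_x$ into $F_{\varphi(x)}$ and $\Phi_x:=\Phi|_{E_x}$ is bounded and linear; for each $s\in\mathcal M_E$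 there is $t\in\mathcal M_F$ with $\Phi\circ s=t\circ\varphi$ almost everywhere; and $\|\Phi\|:=\operatorname{ess\,sup}_x\|\Phi_x\|<\infty$. It is *isometric* if $\Phi_x$ is isometric for almost every $x$. It induces the bounded operators $\mathcal T_\Phi\colon\Gamma^p(E)\to\Gamma^p(F)$, $\mathcal T_\Phi s=\Phi\circ s\circ\varphi^{-1}$, for $p\in\{1,\infty\}$. **(2)** Let $E,F$ be measurable Banach bundles over $X$ with $E$ separable, and let $\mathcal T\colon\Gamma^1(E)\to\Gamma^1(F)$ be a bounded linear operator. Then (a), (b) and (c) are also equivalent to * (d) there is a morphism $\Phi\colon E\to F$ over $\varphi$ with $\mathcal T=\mathcal T_\Phi$. If (d) holds, then the morphism $\Phi$ in (d) is unique, $|\Phi|\colon x\mapsto\|\Phi_x\|$ defines an element of $L^\infty(X)$, and * $\sup\{|\mathcal T_\Phi s| : s\in\Gamma^\infty(E),\ |s|\le\mathbf 1\}=T_\varphi|\Phi|$, the supremum being taken in the ordered space $L^\infty(X)$; * $\|\Phi\|=\|\mathcal T_\Phi\colon\Gamma^\infty(E)\to\Gamma^\infty(F)\|=\|\mathcal T_\Phi\colon\Gamma^1(E)\to\Gamma^1(F)\|$;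 * $\Phi$ is isometric if and only if $\mathcal T_\Phi\colon\Gamma^1(E)\to\Gamma^1(F)$ is an isometry. -/

import Mathlib

open MeasureTheory Filter
open scoped ENNReal

noncomputable section

namespace MeasBundle

universe u v w w'

/-! ### The commutative algebra `L^∞(X)` -/

section Linfty

variable {𝕜 : Type v} [RCLike 𝕜] {Ω : Type u} [MeasurableSpace Ω] {μ : Measure Ω}

lemma mul_mem_Linfty (f g : Lp 𝕜 ∞ μ) :
    (f : Ω →ₘ[μ] 𝕜) * (g : Ω →ₘ[μ] 𝕜) ∈ Lp 𝕜 ∞ μ := by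
  rw [Lp.mem_Lp_iff_memLp]
  exact (MemLp.mul (Lp.memLp g) (Lp.memLp f)).ae_eq (AEEqFun.coeFn_mul _ _).symm

lemma one_mem_Linfty : (1 : Ω →ₘ[μ] 𝕜) ∈ Lp 𝕜 ∞ μ := by
  rw [Lp.mem_Lp_iff_memLp]
  exact (memLp_top_const (1 : 𝕜)).ae_eq AEEqFun.coeFn_one.symm

instance : Mul (Lp 𝕜 ∞ μ) := ⟨fun f g => ⟨f.1 * g.1, mul_mem_Linfty f g⟩⟩

instance : One (Lp 𝕜 ∞ μ) := ⟨⟨1, one_mem_Linfty⟩⟩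

lemma coeFn_Linfty_mul (f g : Lp 𝕜 ∞ μ) : ∀ᵐ x ∂μ, (f * g : Lp 𝕜 ∞ μ) x = f x * g x :=
  AEEqFun.coeFn_mul f.1 g.1

lemma coeFn_Linfty_one : ∀ᵐ x ∂μ, (1 : Lp 𝕜 ∞ μ) x = 1 :=
  AEEqFun.coeFn_one (α := Ω) (β := 𝕜) (μ := μ)

/-- `L^∞(X)` with the almost everywhere pointwise multiplication. -/
instance instCommRingLinfty : CommRing (Lp 𝕜 ∞ μ) where
  __ := (inferInstance : AddCommGroup (Lp 𝕜 ∞ μ))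
  mul_assoc f g h := Subtype.ext (mul_assoc f.1 g.1 h.1)
  one_mul f := Subtype.ext (one_mul f.1)
  mul_one f := Subtype.ext (mul_one f.1)
  mul_comm f g := Subtype.ext (mul_comm f.1 g.1)
  left_distrib f g h := Lp.ext <| by
    filter_upwards [coeFn_Linfty_mul f (g + h), coeFn_Linfty_mul f g, coeFn_Linfty_mul f h,
      Lp.coeFn_add g h, Lp.coeFn_add (f * g) (f * h)] with x h1 h2 h3 h4 h5
    rw [h1, h5, h4, Pi.add_apply, Pi.add_apply, h2, h3, mul_add]
  right_distrib f g h := Lp.ext <| by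
    filter_upwards [coeFn_Linfty_mul (f + g) h, coeFn_Linfty_mul f h, coeFn_Linfty_mul g h,
      Lp.coeFn_add f g, Lp.coeFn_add (f * h) (g * h)] with x h1 h2 h3 h4 h5
    rw [h1, h5, h4, Pi.add_apply, Pi.add_apply, h2, h3, add_mul]
  zero_mul f := Lp.ext <| by
    filter_upwards [coeFn_Linfty_mul 0 f, Lp.coeFn_zero 𝕜 ∞ μ] with x h1 h2
    rw [h1, h2, Pi.zero_apply, zero_mul]
  mul_zero f := Lp.ext <| by
    filter_upwards [coeFn_Linfty_mul f 0, Lp.coeFn_zero 𝕜 ∞ μ] with x h1 h2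
    rw [h1, h2, Pi.zero_apply, mul_zero]

lemma ae_norm_le_Linfty (f : Lp 𝕜 ∞ μ) : ∀ᵐ x ∂μ, ‖f x‖ ≤ ‖f‖ := by
  filter_upwards [ae_le_eLpNormEssSup (f := f) (μ := μ)] with x hx
  rw [Lp.norm_def, eLpNorm_exponent_top, ← toReal_enorm]
  refine ENNReal.toReal_mono ?_ hx
  rw [← eLpNorm_exponent_top]
  exact Lp.eLpNorm_ne_top f

end Linfty

/-! ### Automorphisms of a measure space and their Koopman operators -/

/-- (A representative of) an automorphism of the measure space `(Ω, μ)`: a measure-preserving map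
having a measure-preserving inverse up to null sets. -/
structure MeasureAut {Ω : Type u} [MeasurableSpace Ω] (μ : Measure Ω) where
  toFun : Ω → Ω
  invFun : Ω → Ω
  measurePreserving : MeasurePreserving toFun μ μ
  measurePreserving_inv : MeasurePreserving invFun μ μ
  left_inv : ∀ᵐ x ∂μ, invFun (toFun x) = x
  right_inv : ∀ᵐ x ∂μ, toFun (invFun x) = x

/-- The Koopman operator `f ↦ f ∘ φ⁻¹` on `L^p(X)`. -/
def MeasureAut.koopman {Ω : Type u} [MeasurableSpace Ω] {μ : Measure Ω} (φ : MeasureAut μ)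
    {V : Type v} [NormedAddCommGroup V] {p : ℝ≥0∞} (f : Lp V p μ) : Lp V p μ :=
  Lp.compMeasurePreserving φ.invFun φ.measurePreserving_inv f

/-! ### `L^1(X)`-normed modules -/

/-- A Banach module over `L^∞(X)` with an `L^1(X)`-valued norm; completeness of `Γ` is the separate
assumption `[CompleteSpace Γ]`. The law `1 • s = s` in `Module` is non-degeneracy of the
module. -/
class L1NormedModule (𝕜 : Type v) [RCLike 𝕜] {Ω : Type u} [MeasurableSpace Ω] (μ : Measure Ω)
    (Γ : Type w) [NormedAddCommGroup Γ] [NormedSpace 𝕜 Γ] extends Module (Lp 𝕜 ∞ μ) Γ where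
  smul_assoc' : ∀ (c : 𝕜) (f : Lp 𝕜 ∞ μ) (s : Γ), (c • f) • s = c • (f • s)
  norm_smul_le' : ∀ (f : Lp 𝕜 ∞ μ) (s : Γ), ‖f • s‖ ≤ ‖f‖ * ‖s‖
  /-- the vector-valued norm `|·|` -/
  vnorm : Γ → Lp ℝ 1 μ
  vnorm_nonneg : ∀ s, 0 ≤ vnorm s
  norm_vnorm : ∀ s, ‖vnorm s‖ = ‖s‖
  vnorm_smul : ∀ (f : Lp 𝕜 ∞ μ) (s : Γ), ∀ᵐ x ∂μ, vnorm (f • s) x = ‖f x‖ * vnorm s x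
  vnorm_add_le : ∀ s t, vnorm (s + t) ≤ vnorm s + vnorm t


section Operators

variable {𝕜 : Type v} [RCLike 𝕜] {Ω : Type u} [MeasurableSpace Ω] {μ : Measure Ω}
  {Γ : Type w} [NormedAddCommGroup Γ] [NormedSpace 𝕜 Γ] [L1NormedModule 𝕜 μ Γ]
  {Λ : Type*} [NormedAddCommGroup Λ] [NormedSpace 𝕜 Λ] [L1NormedModule 𝕜 μ Λ]

/-- `T` is a `T_φ`-homomorphism. -/
def IsKoopmanHom (φ : MeasureAut μ) (T : Γ →L[𝕜] Λ) : Prop :=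
  ∀ (f : Lp 𝕜 ∞ μ) (s : Γ), T (f • s) = φ.koopman f • T s

/-- `|T s| ≤ m · T_φ |s|` in `L^1(X)` for all `s`. -/
def IsDominatedBy (φ : MeasureAut μ) (T : Γ →L[𝕜] Λ) (m : ℝ) : Prop :=
  ∀ s : Γ, L1NormedModule.vnorm 𝕜 (T s) ≤ m • φ.koopman (L1NormedModule.vnorm 𝕜 s : Lp ℝ 1 μ)

end Operators

/-! ### Measurable Banach bundles and their spaces of sections -/

/-- A measurable Banach bundle over `(Ω, μ)` with fibres `E x`, given by its space of measurable
sections. The total space is `Σ x, E x`. -/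
structure MeasurableBundle (𝕜 : Type v) [RCLike 𝕜] {Ω : Type u} [MeasurableSpace Ω]
    (μ : Measure Ω) (E : Ω → Type w) [∀ x, NormedAddCommGroup (E x)]
    [∀ x, NormedSpace 𝕜 (E x)] where
  sections : Submodule 𝕜 (∀ x, E x)
  smul_mem : ∀ f : Ω → 𝕜, Measurable f → ∀ s ∈ sections, (fun x => f x • s x) ∈ sections
  measurable_norm : ∀ s ∈ sections, Measurable fun x => ‖s x‖
  lim_mem : ∀ (t : ℕ → ∀ x, E x) (s : ∀ x, E x), (∀ n, t n ∈ sections) →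
    (∀ᵐ x ∂μ, Tendsto (fun n => t n x) atTop (nhds (s x))) → s ∈ sections

namespace MeasurableBundle

variable {𝕜 : Type v} [RCLike 𝕜] {Ω : Type u} [MeasurableSpace Ω] {μ : Measure Ω}
  {E : Ω → Type w} [∀ x, NormedAddCommGroup (E x)] [∀ x, NormedSpace 𝕜 (E x)]

/-- Some sequence of measurable sections spans a dense subspace in almost every fibre. -/
def IsSeparable (B : MeasurableBundle 𝕜 μ E) : Prop :=
  ∃ s : ℕ → ∀ x, E x, (∀ n, s n ∈ B.sections) ∧
    ∀ᵐ x ∂μ, Dense (Submodule.span 𝕜 (Set.range fun n => s n x) : Set (E x))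

variable (B : MeasurableBundle 𝕜 μ E)

/-- Measurable sections vanishing almost everywhere. -/
def null : Submodule 𝕜 B.sections where
  carrier := {s | ∀ᵐ x ∂μ, s.1 x = 0}
  zero_mem' := by
    rw [Set.mem_ofPred_eq]
    exact Eventually.of_forall fun _ => rfl
  add_mem' {s t} hs ht := by
    rw [Set.mem_ofPred_eq] at *
    filter_upwards [hs, ht] with x h1 h2
    simp [h1, h2]
  smul_mem' c s hs := by
    rw [Set.mem_ofPred_eq] at *
    filter_upwards [hs] with x h
    simp [h]

/-- Measurable sections modulo almost everywhere equality. -/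
abbrev L0 : Type _ := B.sections ⧸ B.null

variable {B} in
lemma mk_eq_mk {s t : B.sections} :
    (Submodule.Quotient.mk s : B.L0) = Submodule.Quotient.mk t ↔ ∀ᵐ x ∂μ, s.1 x = t.1 x := by
  rw [Submodule.Quotient.eq]
  change (∀ᵐ x ∂μ, s.1 x - t.1 x = 0) ↔ _
  simp only [sub_eq_zero]

lemma aestronglyMeasurable_norm (s : B.sections) :
    AEStronglyMeasurable (fun x => ‖s.1 x‖) μ :=
  (B.measurable_norm s.1 s.2).aestronglyMeasurable

/-- `|s|`, as an almost everywhere class of functions. -/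
def absVal (q : B.L0) : Ω →ₘ[μ] ℝ :=
  Quotient.liftOn' q (fun s => AEEqFun.mk (fun x => ‖s.1 x‖) (B.aestronglyMeasurable_norm s))
    (fun s t h => by
      have h' : (Submodule.Quotient.mk s : B.L0) = Submodule.Quotient.mk t := Quotient.sound' h
      rw [mk_eq_mk] at h'
      rw [AEEqFun.mk_eq_mk]
      filter_upwards [h'] with x hx
      rw [hx])

lemma absVal_mk (s : B.sections) :
    ∀ᵐ x ∂μ, B.absVal (Submodule.Quotient.mk s) x = ‖s.1 x‖ :=
  AEEqFun.coeFn_mk _ (B.aestronglyMeasurable_norm s)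

lemma absVal_nonneg (q : B.L0) : ∀ᵐ x ∂μ, 0 ≤ B.absVal q x := by
  obtain ⟨s, rfl⟩ := Submodule.Quotient.mk_surjective _ q
  filter_upwards [B.absVal_mk s] with x hx
  rw [hx]; exact norm_nonneg _

lemma absVal_add_le (q r : B.L0) : ∀ᵐ x ∂μ, B.absVal (q + r) x ≤ B.absVal q x + B.absVal r x := by
  obtain ⟨s, rfl⟩ := Submodule.Quotient.mk_surjective _ q
  obtain ⟨t, rfl⟩ := Submodule.Quotient.mk_surjective _ r
  rw [← Submodule.Quotient.mk_add]
  filter_upwards [B.absVal_mk s, B.absVal_mk t, B.absVal_mk (s + t)] with x h1 h2 h3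
  rw [h1, h2, h3]; exact norm_add_le _ _

lemma absVal_smul (c : 𝕜) (q : B.L0) : ∀ᵐ x ∂μ, B.absVal (c • q) x = ‖c‖ * B.absVal q x := by
  obtain ⟨s, rfl⟩ := Submodule.Quotient.mk_surjective _ q
  rw [← Submodule.Quotient.mk_smul]
  filter_upwards [B.absVal_mk s, B.absVal_mk (c • s)] with x h1 h2
  rw [h1, h2]; exact norm_smul _ _

lemma absVal_zero : ∀ᵐ x ∂μ, B.absVal (0 : B.L0) x = 0 := by
  rw [← Submodule.Quotient.mk_zero]
  filter_upwards [B.absVal_mk 0] with x h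
  rw [h]; exact norm_zero

lemma eq_zero_of_absVal (q : B.L0) (h : ∀ᵐ x ∂μ, B.absVal q x = 0) : q = 0 := by
  obtain ⟨s, rfl⟩ := Submodule.Quotient.mk_surjective _ q
  rw [← Submodule.Quotient.mk_zero, mk_eq_mk]
  filter_upwards [h, B.absVal_mk s] with x h1 h2
  rw [h2] at h1
  exact norm_eq_zero.1 h1

/-- The subspace of `L0` of all `s` with `|s| ∈ L^p(X)`. -/
def secSubmodule (p : ℝ≥0∞) : Submodule 𝕜 B.L0 where
  carrier := {q | B.absVal q ∈ Lp ℝ p μ}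
  zero_mem' := by
    rw [Set.mem_ofPred_eq]
    refine Lp.mem_Lp_of_ae_le (g := (0 : Lp ℝ p μ)) ?_
    filter_upwards [B.absVal_zero] with x hx
    rw [hx, norm_zero]; exact norm_nonneg _
  add_mem' {q r} hq hr := by
    rw [Set.mem_ofPred_eq] at *
    refine Lp.mem_Lp_of_ae_le (g := (⟨_, hq⟩ + ⟨_, hr⟩ : Lp ℝ p μ)) ?_
    filter_upwards [B.absVal_nonneg (q + r), B.absVal_add_le q r,
      Lp.coeFn_add (⟨_, hq⟩ : Lp ℝ p μ) ⟨_, hr⟩] with x h1 h2 h3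
    rw [h3, Real.norm_of_nonneg h1]
    exact h2.trans (le_abs_self _)
  smul_mem' c q hq := by
    rw [Set.mem_ofPred_eq] at *
    refine Lp.mem_Lp_of_ae_le_mul (c := ‖c‖) (g := (⟨_, hq⟩ : Lp ℝ p μ)) ?_
    filter_upwards [B.absVal_smul c q] with x h1
    rw [h1, norm_mul, norm_norm]

/-- `Γ^p(E)`; the cases of interest are `p = 1` and `p = ∞`. -/
def Sec (p : ℝ≥0∞) : Type _ := B.secSubmodule p

instance {p : ℝ≥0∞} : AddCommGroup (B.Sec p) := inferInstanceAs (AddCommGroup (B.secSubmodule p))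

instance {p : ℝ≥0∞} : Module 𝕜 (B.Sec p) := inferInstanceAs (Module 𝕜 (B.secSubmodule p))

/-- `|s| ∈ L^p(X)` for `s ∈ Γ^p(E)`. -/
def secAbs {p : ℝ≥0∞} (s : B.Sec p) : Lp ℝ p μ :=
  ⟨B.absVal s.1, s.2⟩

instance {p : ℝ≥0∞} : Norm (B.Sec p) := ⟨fun s => ‖B.secAbs s‖⟩

lemma norm_sec_def {p : ℝ≥0∞} (s : B.Sec p) : ‖s‖ = ‖B.secAbs s‖ := rfl

lemma sec_norm_smul {p : ℝ≥0∞} [Fact (1 ≤ p)] (c : 𝕜) (s : B.Sec p) : ‖c • s‖ = ‖c‖ * ‖s‖ := by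
  rw [norm_sec_def, norm_sec_def]
  have h : B.secAbs (c • s) = ‖c‖ • B.secAbs s := Lp.ext <| by
    filter_upwards [B.absVal_smul c s.1, Lp.coeFn_smul ‖c‖ (B.secAbs s)] with x h1 h2
    rw [h2]; exact h1
  rw [h, norm_smul, norm_norm]

/-- `Γ^p(E)` is normed by `‖s‖ = ‖|s|‖_p`. -/
instance {p : ℝ≥0∞} [hp : Fact (1 ≤ p)] : NormedAddCommGroup (B.Sec p) :=
  AddGroupNorm.toNormedAddCommGroup
    { toFun := fun s => ‖s‖
      map_zero' := by
        have h := B.sec_norm_smul (p := p) (0 : 𝕜) 0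
        rwa [norm_zero, zero_mul, smul_zero] at h
      add_le' := fun s t => by
        refine le_trans (Lp.norm_le_norm_of_ae_le (g := B.secAbs s + B.secAbs t) ?_)
          (norm_add_le _ _)
        filter_upwards [B.absVal_nonneg (s + t).1, B.absVal_add_le s.1 t.1,
          Lp.coeFn_add (B.secAbs s) (B.secAbs t)] with x h1 h2 h3
        rw [h3]
        exact (Real.norm_of_nonneg h1).le.trans (h2.trans (le_abs_self _))
      neg' := fun s => by
        have h := B.sec_norm_smul (p := p) (-1 : 𝕜) s
        rwa [norm_neg, norm_one, one_mul, neg_smul, one_smul] at h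
      eq_zero_of_map_eq_zero' := fun s h => by
        have h' : B.secAbs s = 0 := norm_eq_zero.1 h
        refine Subtype.ext (B.eq_zero_of_absVal _ ?_)
        have h2 := Lp.coeFn_zero ℝ p μ
        rw [← h'] at h2
        exact h2 }

instance {p : ℝ≥0∞} [hp : Fact (1 ≤ p)] : NormedSpace 𝕜 (B.Sec p) where
  norm_smul_le c s := (B.sec_norm_smul c s).le

/-- Multiplication of measurable sections by (the measurable representative of) `f ∈ L^∞(X)`. -/
def mulSections (f : Lp 𝕜 ∞ μ) : B.sections →ₗ[𝕜] B.sections where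
  toFun s := ⟨fun x => f x • s.1 x, B.smul_mem f (Lp.stronglyMeasurable f).measurable s.1 s.2⟩
  map_add' s t := Subtype.ext <| funext fun x => smul_add (f x) (s.1 x) (t.1 x)
  map_smul' c s := Subtype.ext <| funext fun x => smul_comm (f x) c (s.1 x)

/-- `f [s] = [f s]`. -/
def mulL0 (f : Lp 𝕜 ∞ μ) : B.L0 →ₗ[𝕜] B.L0 :=
  Submodule.mapQ B.null B.null (B.mulSections f) <| by
    intro s (hs : ∀ᵐ x ∂μ, s.1 x = 0)
    change ∀ᵐ x ∂μ, f x • s.1 x = 0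
    filter_upwards [hs] with x hx
    rw [hx, smul_zero]

lemma mulL0_mk (f : Lp 𝕜 ∞ μ) (s : B.sections) :
    B.mulL0 f (Submodule.Quotient.mk s) = Submodule.Quotient.mk (B.mulSections f s) := rfl

lemma absVal_mulL0 (f : Lp 𝕜 ∞ μ) (q : B.L0) :
    ∀ᵐ x ∂μ, B.absVal (B.mulL0 f q) x = ‖f x‖ * B.absVal q x := by
  obtain ⟨s, rfl⟩ := Submodule.Quotient.mk_surjective _ q
  rw [mulL0_mk]
  filter_upwards [B.absVal_mk s, B.absVal_mk (B.mulSections f s)] with x h1 h2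
  rw [h1, h2]; exact norm_smul _ _

lemma mulL0_mem {p : ℝ≥0∞} (f : Lp 𝕜 ∞ μ) {q : B.L0} (hq : q ∈ B.secSubmodule p) :
    B.mulL0 f q ∈ B.secSubmodule p := by
  refine Lp.mem_Lp_of_ae_le_mul (c := ‖f‖) (g := (⟨_, hq⟩ : Lp ℝ p μ)) ?_
  filter_upwards [B.absVal_mulL0 f q, ae_norm_le_Linfty f] with x h1 h2
  rw [h1, norm_mul, norm_norm]
  exact mul_le_mul_of_nonneg_right h2 (norm_nonneg _)

/-- `Γ^p(E)` as a module over `L^∞(X)`. -/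
instance {p : ℝ≥0∞} : Module (Lp 𝕜 ∞ μ) (B.Sec p) where
  smul f s := ⟨B.mulL0 f s.1, B.mulL0_mem f s.2⟩
  smul_zero f := Subtype.ext (map_zero (B.mulL0 f))
  smul_add f s t := Subtype.ext (map_add (B.mulL0 f) s.1 t.1)
  one_smul := by
    rintro ⟨q, hq⟩
    obtain ⟨s, rfl⟩ := Submodule.Quotient.mk_surjective _ q
    refine Subtype.ext (mk_eq_mk.2 ?_)
    filter_upwards [coeFn_Linfty_one (𝕜 := 𝕜) (μ := μ)] with x hx
    change (1 : Lp 𝕜 ∞ μ) x • s.1 x = s.1 x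
    rw [hx, one_smul]
  mul_smul := by
    rintro f g ⟨q, hq⟩
    obtain ⟨s, rfl⟩ := Submodule.Quotient.mk_surjective _ q
    refine Subtype.ext (mk_eq_mk.2 ?_)
    filter_upwards [coeFn_Linfty_mul f g] with x hx
    change (f * g : Lp 𝕜 ∞ μ) x • s.1 x = f x • g x • s.1 x
    rw [hx, mul_smul]
  add_smul := by
    rintro f g ⟨q, hq⟩
    obtain ⟨s, rfl⟩ := Submodule.Quotient.mk_surjective _ q
    refine Subtype.ext (mk_eq_mk.2 ?_)
    filter_upwards [Lp.coeFn_add f g] with x hx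
    change (f + g : Lp 𝕜 ∞ μ) x • s.1 x = f x • s.1 x + g x • s.1 x
    rw [hx, Pi.add_apply, add_smul]
  zero_smul := by
    rintro ⟨q, hq⟩
    obtain ⟨s, rfl⟩ := Submodule.Quotient.mk_surjective _ q
    refine Subtype.ext (mk_eq_mk.2 ?_)
    filter_upwards [Lp.coeFn_zero 𝕜 ∞ μ] with x hx
    change (0 : Lp 𝕜 ∞ μ) x • s.1 x = 0
    rw [hx, Pi.zero_apply, zero_smul]

lemma secAbs_smul {p : ℝ≥0∞} (f : Lp 𝕜 ∞ μ) (s : B.Sec p) :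
    ∀ᵐ x ∂μ, B.secAbs (f • s) x = ‖f x‖ * B.secAbs s x :=
  B.absVal_mulL0 f s.1

/-- `Γ^1(E)` with `|s| = ‖s(·)‖` is an `L^1(X)`-normed module. -/
instance : L1NormedModule 𝕜 μ (B.Sec 1) where
  smul_assoc' c f := by
    rintro ⟨q, hq⟩
    obtain ⟨s, rfl⟩ := Submodule.Quotient.mk_surjective _ q
    refine Subtype.ext (mk_eq_mk.2 ?_)
    filter_upwards [Lp.coeFn_smul c f] with x hx
    change (c • f : Lp 𝕜 ∞ μ) x • s.1 x = c • f x • s.1 x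
    rw [hx, Pi.smul_apply, smul_assoc]
  norm_smul_le' f s := by
    refine Lp.norm_le_mul_norm_of_ae_le_mul ?_
    filter_upwards [B.secAbs_smul f s, ae_norm_le_Linfty f] with x h1 h2
    rw [h1, norm_mul, norm_norm]
    exact mul_le_mul_of_nonneg_right h2 (norm_nonneg _)
  vnorm := B.secAbs
  vnorm_nonneg s := by
    rw [← Lp.coeFn_nonneg]
    exact B.absVal_nonneg s.1
  norm_vnorm s := rfl
  vnorm_smul := B.secAbs_smul
  vnorm_add_le s t := by
    rw [← Lp.coeFn_le]
    filter_upwards [B.absVal_add_le s.1 t.1, Lp.coeFn_add (B.secAbs s) (B.secAbs t)] with x h1 h2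
    rw [h2]
    exact h1

end MeasurableBundle
/-! ### Morphisms of measurable Banach bundles and weighted Koopman operators -/

section Morphisms

variable {𝕜 : Type v} [RCLike 𝕜] {Ω : Type u} [MeasurableSpace Ω] {μ : Measure Ω}
  {E : Ω → Type w} [∀ x, NormedAddCommGroup (E x)] [∀ x, NormedSpace 𝕜 (E x)]
  {F : Ω → Type w'} [∀ x, NormedAddCommGroup (F x)] [∀ x, NormedSpace 𝕜 (F x)]

/-- `‖Φ|_{E_x}‖`, the supremum of `‖Φ v‖` over the unit ball of `E_x`. -/
def fiberNorm (Φ : (Σ x, E x) → Σ x, F x) (x : Ω) : ℝ≥0∞ :=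
  ⨆ (v : E x) (_ : ‖v‖ ≤ 1), ‖(Φ ⟨x, v⟩).2‖ₑ

/-- A premorphism from `E` to `F` over `φ`: a map between the total spaces with
`Φ ∘ M_E ⊆ M_F ∘ φ` (almost everywhere), which for almost every `x` maps `E_x` into `F_{φ(x)}` as
a bounded linear operator, with essentially bounded fibre norms. -/
structure Premorphism (φ : MeasureAut μ) (B : MeasurableBundle 𝕜 μ E)
    (C : MeasurableBundle 𝕜 μ F) where
  toFun : (Σ x, E x) → Σ x, F x
  map_sections : ∀ s ∈ B.sections, ∃ t ∈ C.sections,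
    ∀ᵐ x ∂μ, toFun ⟨x, s x⟩ = ⟨φ.toFun x, t (φ.toFun x)⟩
  fiber_linear : ∀ᵐ x ∂μ, ∃ L : E x →L[𝕜] F (φ.toFun x),
    ∀ v : E x, toFun ⟨x, v⟩ = ⟨φ.toFun x, L v⟩
  bounded : essSup (fiberNorm toFun) μ < ∞

namespace Premorphism

variable {φ : MeasureAut μ} {B : MeasurableBundle 𝕜 μ E} {C : MeasurableBundle 𝕜 μ F}

/-- `‖Φ‖ = ess sup ‖Φ|_{E_x}‖`. -/
def norm (Φ : Premorphism φ B C) : ℝ := (essSup (fiberNorm Φ.toFun) μ).toReal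

/-- `Φ|_{E_x}` is isometric for almost every `x`. -/
def IsIsometric (Φ : Premorphism φ B C) : Prop :=
  ∀ᵐ x ∂μ, ∀ v : E x, ‖(Φ.toFun ⟨x, v⟩).2‖ = ‖v‖

lemma exists_image (Φ : Premorphism φ B C) (s : B.sections) : ∃ t : C.sections,
    ∀ᵐ y ∂μ, Φ.toFun ⟨φ.invFun y, s.1 (φ.invFun y)⟩ = ⟨y, t.1 y⟩ := by
  obtain ⟨t, ht, h⟩ := Φ.map_sections s.1 s.2
  refine ⟨⟨t, ht⟩, ?_⟩
  filter_upwards [φ.measurePreserving_inv.quasiMeasurePreserving.ae h, φ.right_inv] with y h1 h2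
  exact h1.trans (congrArg (fun z => (⟨z, t z⟩ : Σ x, F x)) h2)

lemma fiber_linear' (Φ : Premorphism φ B C) : ∀ᵐ y ∂μ, ∃ L : E (φ.invFun y) →L[𝕜] F y,
    (∀ v, Φ.toFun ⟨φ.invFun y, v⟩ = ⟨y, L v⟩) ∧ ∀ v, ‖L v‖ ≤ Φ.norm * ‖v‖ := by
  filter_upwards [φ.measurePreserving_inv.quasiMeasurePreserving.ae Φ.fiber_linear, φ.right_inv,
    φ.measurePreserving_inv.quasiMeasurePreserving.ae
      (ENNReal.ae_le_essSup (μ := μ) (fiberNorm Φ.toFun))] with y h1 h2 h3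
  obtain ⟨L, hL⟩ := h1
  generalize φ.toFun (φ.invFun y) = z at h2 L hL
  subst h2
  refine ⟨L, hL, fun v => ?_⟩
  by_cases hv : v = 0
  · simp [hv]
  have hv' : 0 < ‖v‖ := norm_pos_iff.2 hv
  have h4 : ‖L (((‖v‖⁻¹ : ℝ) : 𝕜) • v)‖ₑ ≤ fiberNorm Φ.toFun (φ.invFun z) := by
    have h5 : ‖((‖v‖⁻¹ : ℝ) : 𝕜) • v‖ ≤ 1 := by
      rw [norm_smul, RCLike.norm_ofReal, abs_of_nonneg (by positivity)]
      exact (inv_mul_cancel₀ hv'.ne').le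
    exact le_trans (le_of_eq (congrArg (fun z : Σ x, F x => ‖z.2‖ₑ) (hL _)).symm)
      (le_iSup₂ (f := fun (v : E (φ.invFun z)) (_ : ‖v‖ ≤ 1) =>
        ‖(Φ.toFun ⟨φ.invFun z, v⟩).2‖ₑ) _ h5)
  have h6 := ENNReal.toReal_mono Φ.bounded.ne (h4.trans h3)
  rw [toReal_enorm, map_smul, norm_smul, RCLike.norm_ofReal, abs_of_nonneg (by positivity)] at h6
  have h7 : ‖v‖⁻¹ * ‖L v‖ ≤ Φ.norm := h6
  rwa [inv_mul_le_iff₀ hv', mul_comm] at h7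

/-- The class of `Φ ∘ s ∘ φ⁻¹`. -/
def push (Φ : Premorphism φ B C) (s : B.sections) : C.L0 :=
  Submodule.Quotient.mk (Φ.exists_image s).choose

lemma push_eq_mk_iff (Φ : Premorphism φ B C) (s : B.sections) (t : C.sections) :
    Φ.push s = Submodule.Quotient.mk t ↔
      ∀ᵐ y ∂μ, Φ.toFun ⟨φ.invFun y, s.1 (φ.invFun y)⟩ = ⟨y, t.1 y⟩ := by
  have h := (Φ.exists_image s).choose_spec
  rw [push, MeasurableBundle.mk_eq_mk]
  constructor
  · intro h'
    filter_upwards [h, h'] with y h1 h2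
    rw [h1, h2]
  · intro h'
    filter_upwards [h, h'] with y h1 h2
    exact eq_of_heq (Sigma.mk.inj (h1.symm.trans h2)).2

lemma push_eq_mk_iff_linear (Φ : Premorphism φ B C) (s : B.sections) : ∃ t : C.sections,
    Φ.push s = Submodule.Quotient.mk t ∧
      ∀ᵐ y ∂μ, ∀ L : E (φ.invFun y) →L[𝕜] F y,
        (∀ v, Φ.toFun ⟨φ.invFun y, v⟩ = ⟨y, L v⟩) → t.1 y = L (s.1 (φ.invFun y)) := by
  obtain ⟨t, ht⟩ := Φ.exists_image s
  refine ⟨t, (Φ.push_eq_mk_iff s t).2 ht, ?_⟩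
  filter_upwards [ht] with y hy L hL
  exact eq_of_heq (Sigma.mk.inj (hy.symm.trans (hL _))).2

/-- The weighted Koopman operator `s ↦ Φ ∘ s ∘ φ⁻¹` on all measurable sections. -/
def koopmanL0 (Φ : Premorphism φ B C) : B.L0 →ₗ[𝕜] C.L0 :=
  Submodule.liftQ B.null
    { toFun := Φ.push
      map_add' := fun s s' => by
        obtain ⟨t, ht, h⟩ := Φ.push_eq_mk_iff_linear s
        obtain ⟨t', ht', h'⟩ := Φ.push_eq_mk_iff_linear s'
        rw [ht, ht', ← Submodule.Quotient.mk_add, push_eq_mk_iff]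
        filter_upwards [h, h', Φ.fiber_linear'] with y h1 h2 ⟨L, hL, _⟩
        rw [hL]
        change (⟨y, L (s.1 _ + s'.1 _)⟩ : Σ x, F x) = ⟨y, t.1 y + t'.1 y⟩
        rw [h1 L hL, h2 L hL, map_add]
      map_smul' := fun c s => by
        obtain ⟨t, ht, h⟩ := Φ.push_eq_mk_iff_linear s
        rw [ht, RingHom.id_apply, ← Submodule.Quotient.mk_smul, push_eq_mk_iff]
        filter_upwards [h, Φ.fiber_linear'] with y h1 ⟨L, hL, _⟩
        rw [hL]
        change (⟨y, L (c • s.1 _)⟩ : Σ x, F x) = ⟨y, c • t.1 y⟩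
        rw [h1 L hL, map_smul] } <| by
    intro s (hs : ∀ᵐ x ∂μ, s.1 x = 0)
    rw [LinearMap.mem_ker]
    change Φ.push s = 0
    rw [← Submodule.Quotient.mk_zero, push_eq_mk_iff]
    filter_upwards [φ.measurePreserving_inv.quasiMeasurePreserving.ae hs, Φ.fiber_linear']
      with y h1 ⟨L, hL, _⟩
    rw [hL, h1, map_zero]
    rfl

lemma koopmanL0_mk_eq_mk_iff (Φ : Premorphism φ B C) (s : B.sections) (t : C.sections) :
    Φ.koopmanL0 (Submodule.Quotient.mk s) = Submodule.Quotient.mk t ↔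
      ∀ᵐ y ∂μ, Φ.toFun ⟨φ.invFun y, s.1 (φ.invFun y)⟩ = ⟨y, t.1 y⟩ :=
  Φ.push_eq_mk_iff s t

lemma absVal_koopmanL0_le (Φ : Premorphism φ B C) (q : B.L0) :
    ∀ᵐ y ∂μ, C.absVal (Φ.koopmanL0 q) y ≤ Φ.norm * B.absVal q (φ.invFun y) := by
  obtain ⟨s, rfl⟩ := Submodule.Quotient.mk_surjective _ q
  obtain ⟨t, ht, h⟩ := Φ.push_eq_mk_iff_linear s
  have ht' : Φ.koopmanL0 (Submodule.Quotient.mk s) = Submodule.Quotient.mk t := ht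
  rw [ht']
  filter_upwards [h, Φ.fiber_linear', C.absVal_mk t,
    φ.measurePreserving_inv.quasiMeasurePreserving.ae (B.absVal_mk s)] with y h1 ⟨L, hL, hn⟩ h3 h4
  rw [h3, h4, h1 L hL]
  exact hn _

lemma norm_koopmanL0_le (Φ : Premorphism φ B C) {p : ℝ≥0∞} (s : B.Sec p) :
    ∀ᵐ y ∂μ, ‖C.absVal (Φ.koopmanL0 s.1) y‖ ≤ Φ.norm * ‖φ.koopman (B.secAbs s) y‖ := by
  filter_upwards [Φ.absVal_koopmanL0_le s.1, C.absVal_nonneg (Φ.koopmanL0 s.1),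
    Lp.coeFn_compMeasurePreserving (B.secAbs s) φ.measurePreserving_inv,
    φ.measurePreserving_inv.quasiMeasurePreserving.ae (B.absVal_nonneg s.1)] with y h1 h2 h3 h4
  rw [MeasureAut.koopman, h3, Real.norm_of_nonneg h2]
  exact h1.trans (mul_le_mul_of_nonneg_left (le_abs_self _) ENNReal.toReal_nonneg)

/-- The weighted Koopman operator `𝒯_Φ s = Φ ∘ s ∘ φ⁻¹` from `Γ^p(E)` to `Γ^p(F)`. -/
def koopman (Φ : Premorphism φ B C) (p : ℝ≥0∞) [Fact (1 ≤ p)] : B.Sec p →L[𝕜] C.Sec p :=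
  LinearMap.mkContinuous
    (Φ.koopmanL0.restrict (p := B.secSubmodule p) (q := C.secSubmodule p)
      fun q hq => Lp.mem_Lp_of_ae_le_mul (Φ.norm_koopmanL0_le ⟨q, hq⟩))
    Φ.norm fun s => by
      refine (Lp.norm_le_mul_norm_of_ae_le_mul (g := φ.koopman (B.secAbs s))
        (Φ.norm_koopmanL0_le s)).trans (le_of_eq ?_)
      rw [MeasureAut.koopman, Lp.norm_compMeasurePreserving]
      rfl

/-- Two premorphisms are identified if they agree almost everywhere. -/
instance setoid (φ : MeasureAut μ) (B : MeasurableBundle 𝕜 μ E) (C : MeasurableBundle 𝕜 μ F) :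
    Setoid (Premorphism φ B C) where
  r Φ Ψ := ∀ᵐ x ∂μ, ∀ v : E x, Φ.toFun ⟨x, v⟩ = Ψ.toFun ⟨x, v⟩
  iseqv :=
    { refl := fun _ => Eventually.of_forall fun _ _ => rfl
      symm := fun h => h.mono fun _ hx v => (hx v).symm
      trans := fun h h' => by
        filter_upwards [h, h'] with x h1 h2 v
        exact (h1 v).trans (h2 v) }

lemma fiberNorm_congr {Φ Ψ : Premorphism φ B C} (h : Φ ≈ Ψ) :
    fiberNorm Φ.toFun =ᵐ[μ] fiberNorm Ψ.toFun := by
  filter_upwards [h] with x hx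
  exact iSup_congr fun v => iSup_congr fun _ => congrArg (fun z : Σ x, F x => ‖z.2‖ₑ) (hx v)

lemma norm_congr {Φ Ψ : Premorphism φ B C} (h : Φ ≈ Ψ) : Φ.norm = Ψ.norm := by
  rw [norm, norm, essSup_congr_ae (fiberNorm_congr h)]

lemma isIsometric_congr {Φ Ψ : Premorphism φ B C} (h : Φ ≈ Ψ) :
    Φ.IsIsometric = Ψ.IsIsometric := by
  refine propext (eventually_congr ?_)
  filter_upwards [h] with x hx
  refine forall_congr' fun v => ?_
  rw [congrArg (fun z : Σ x, F x => ‖z.2‖) (hx v)]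

lemma koopman_congr {Φ Ψ : Premorphism φ B C} (h : Φ ≈ Ψ) (p : ℝ≥0∞) [Fact (1 ≤ p)] :
    Φ.koopman p = Ψ.koopman p := by
  refine ContinuousLinearMap.ext ?_
  rintro ⟨q, hq⟩
  obtain ⟨s, rfl⟩ := Submodule.Quotient.mk_surjective _ q
  refine Subtype.ext ?_
  change Φ.koopmanL0 (Submodule.Quotient.mk s) = Ψ.koopmanL0 (Submodule.Quotient.mk s)
  obtain ⟨t, ht⟩ := Submodule.Quotient.mk_surjective _ (Ψ.koopmanL0 (Submodule.Quotient.mk s))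
  rw [← ht, koopmanL0_mk_eq_mk_iff]
  filter_upwards [(Ψ.koopmanL0_mk_eq_mk_iff s t).1 ht.symm,
    φ.measurePreserving_inv.quasiMeasurePreserving.ae h] with y h1 h2
  rw [h2, h1]

end Premorphism

/-- Morphisms of measurable Banach bundles from `E` to `F` over `φ`. -/
def Morphism (φ : MeasureAut μ) (B : MeasurableBundle 𝕜 μ E) (C : MeasurableBundle 𝕜 μ F) :
    Type _ :=
  Quotient (Premorphism.setoid φ B C)

namespace Morphism

variable {φ : MeasureAut μ} {B : MeasurableBundle 𝕜 μ E} {C : MeasurableBundle 𝕜 μ F}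

/-- The premorphism `Ψ` represents the morphism `Φ`. -/
def IsRepresentedBy (Φ : Morphism φ B C) (Ψ : Premorphism φ B C) : Prop :=
  Φ = Quotient.mk (Premorphism.setoid φ B C) Ψ

/-- `‖Φ‖`. -/
def norm (Φ : Morphism φ B C) : ℝ :=
  Quotient.lift Premorphism.norm (fun _ _ h => Premorphism.norm_congr h) Φ

/-- `Φ` is isometric. -/
def IsIsometric (Φ : Morphism φ B C) : Prop :=
  Quotient.lift Premorphism.IsIsometric (fun _ _ h => Premorphism.isIsometric_congr h) Φ

/-- The weighted Koopman operator `𝒯_Φ` from `Γ^p(E)` to `Γ^p(F)`. -/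
def koopman (Φ : Morphism φ B C) (p : ℝ≥0∞) [Fact (1 ≤ p)] : B.Sec p →L[𝕜] C.Sec p :=
  Quotient.lift (fun Ψ => Ψ.koopman p) (fun _ _ h => Premorphism.koopman_congr h p) Φ

end Morphism

end Morphisms

end MeasBundle

end

open MeasureTheory Filter
open scoped ENNReal

noncomputable section

/-! Domination is a pointwise condition, and it forces locality. Subtracting a constant `c` from `f`
gives `T (f s) - T_φ f · T s = T ((f - c) s) + (c - T_φ f) · T s`. Under (c) the modulus of this at
`y` is at most `|f (φ⁻¹ y) - c|` times a function independent of `c`. Almost everywhere this holds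
for countably many dense `c`, hence for all `c`, and `c = f (φ⁻¹ y)` gives (a). Conversely, (a)
allows the norm inequality to be tested on `1_A · T s`. This bounds all set integrals of `|T s|` and
so gives (b). These steps are `IsDominatedBy.isKoopmanHom` and `IsKoopmanHom.isDominatedBy`.

For bundles, (c) says that the value of `T s` at `φ x` is controlled by the value of `s` at `x`. On
a sequence of integrable sections with fibrewise dense span, `T` therefore defines a bounded
operator `E_x → F_{φ x}` for almost every `x` (`IsDominatedBy.exists_fiber_maps`). Multiplication by
positive functions carries this from integrable sections to all measurable ones.

The recurring difficulty is that each relation holds off a null set depending on the section.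
Separability removes it: a condition that is closed in each fibre need only be checked on countably
many fibrewise dense sections (`IsSeparable.ae_forall`). Uniqueness, the norm formulas and the
isometry criterion are all obtained in this way, the supremum and the `L^∞` norm by testing on
sections normalised to `u / |u|`. -/

namespace MeasBundle

universe u v w w'

/-! ### Transport along the automorphism, and constants in `L^∞(X)`. -/

section Koopman

variable {𝕜 : Type v} [RCLike 𝕜] {Ω : Type u} [MeasurableSpace Ω] {μ : Measure Ω}

lemma MeasureAut.coeFn_koopman (φ : MeasureAut μ) {V : Type*} [NormedAddCommGroup V] {p : ℝ≥0∞}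
    (f : Lp V p μ) : ∀ᵐ y ∂μ, φ.koopman f y = f (φ.invFun y) :=
  Lp.coeFn_compMeasurePreserving f φ.measurePreserving_inv

lemma MeasureAut.norm_koopman (φ : MeasureAut μ) {V : Type*} [NormedAddCommGroup V] {p : ℝ≥0∞}
    (f : Lp V p μ) : ‖φ.koopman f‖ = ‖f‖ :=
  Lp.norm_compMeasurePreserving f φ.measurePreserving_inv

lemma MeasureAut.ae_inv (φ : MeasureAut μ) {P : Ω → Prop} (h : ∀ᵐ x ∂μ, P x) :
    ∀ᵐ y ∂μ, P (φ.invFun y) :=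
  φ.measurePreserving_inv.quasiMeasurePreserving.ae h

lemma MeasureAut.ae_comp (φ : MeasureAut μ) {P : Ω → Prop} (h : ∀ᵐ x ∂μ, P x) :
    ∀ᵐ y ∂μ, P (φ.toFun y) :=
  φ.measurePreserving.quasiMeasurePreserving.ae h

/-- The constant function `c`, as an element of `L^∞(X)`. -/
def constLinfty (μ : Measure Ω) (c : 𝕜) : Lp 𝕜 ∞ μ := c • 1

lemma coeFn_constLinfty (c : 𝕜) : ∀ᵐ x ∂μ, constLinfty μ c x = c := by
  filter_upwards [Lp.coeFn_smul c (1 : Lp 𝕜 ∞ μ), coeFn_Linfty_one (𝕜 := 𝕜) (μ := μ)] with x h1 h2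
  rw [constLinfty, h1, Pi.smul_apply, h2, smul_eq_mul, mul_one]

end Koopman

/-! ### Homomorphisms and dominated operators between `L^1(X)`-normed modules. -/

section Modules

variable {𝕜 : Type v} [RCLike 𝕜] {Ω : Type u} [MeasurableSpace Ω] {μ : Measure Ω}
  {Γ : Type w} [NormedAddCommGroup Γ] [NormedSpace 𝕜 Γ] [L1NormedModule 𝕜 μ Γ]
  {Λ : Type w'} [NormedAddCommGroup Λ] [NormedSpace 𝕜 Λ] [L1NormedModule 𝕜 μ Λ]

open L1NormedModule

lemma constLinfty_smul (c : 𝕜) (s : Γ) : constLinfty μ c • s = c • s := by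
  rw [constLinfty, smul_assoc', one_smul]

variable (𝕜 μ) in
lemma vnorm_nonneg_ae (s : Γ) : ∀ᵐ x ∂μ, 0 ≤ (vnorm 𝕜 s : Lp ℝ 1 μ) x :=
  (Lp.coeFn_nonneg _).2 (vnorm_nonneg (𝕜 := 𝕜) (μ := μ) s)

variable (𝕜 μ) in
lemma vnorm_add_le_ae (s t : Γ) : ∀ᵐ x ∂μ,
    (vnorm 𝕜 (s + t) : Lp ℝ 1 μ) x ≤ (vnorm 𝕜 s : Lp ℝ 1 μ) x + (vnorm 𝕜 t : Lp ℝ 1 μ) x := by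
  filter_upwards [(Lp.coeFn_le _ _).2 (vnorm_add_le (𝕜 := 𝕜) (μ := μ) s t),
    Lp.coeFn_add (vnorm 𝕜 s : Lp ℝ 1 μ) (vnorm 𝕜 t)] with x h1 h2
  rw [h2] at h1
  exact h1

variable (𝕜 μ) in
lemma eq_zero_of_vnorm_le_zero (s : Γ) (h : ∀ᵐ x ∂μ, (vnorm 𝕜 s : Lp ℝ 1 μ) x ≤ 0) : s = 0 := by
  rw [← norm_eq_zero, ← norm_vnorm (𝕜 := 𝕜) (μ := μ), norm_eq_zero]
  refine Lp.ext ?_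
  filter_upwards [h, vnorm_nonneg_ae 𝕜 μ s, Lp.coeFn_zero ℝ 1 μ] with x h1 h2 h3
  rw [h3]
  exact le_antisymm h1 h2

lemma isDominatedBy_iff {φ : MeasureAut μ} {T : Γ →L[𝕜] Λ} {m : ℝ} :
    IsDominatedBy φ T m ↔ ∀ s : Γ, ∀ᵐ y ∂μ,
      (vnorm 𝕜 (T s) : Lp ℝ 1 μ) y ≤ m * (vnorm 𝕜 s : Lp ℝ 1 μ) (φ.invFun y) := by
  refine forall_congr' fun s => ?_
  rw [← Lp.coeFn_le]
  refine eventually_congr ?_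
  filter_upwards [Lp.coeFn_smul m (φ.koopman (vnorm 𝕜 s : Lp ℝ 1 μ)),
    φ.coeFn_koopman (vnorm 𝕜 s : Lp ℝ 1 μ)] with y h1 h2
  rw [h1, Pi.smul_apply, h2, smul_eq_mul]

lemma IsDominatedBy.mono {φ : MeasureAut μ} {T : Γ →L[𝕜] Λ} {m m' : ℝ} (h : IsDominatedBy φ T m)
    (hm : m ≤ m') : IsDominatedBy φ T m' := by
  rw [isDominatedBy_iff] at *
  intro s
  filter_upwards [h s, φ.ae_inv (vnorm_nonneg_ae 𝕜 μ s)] with y h1 h2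
  exact h1.trans (mul_le_mul_of_nonneg_right hm h2)

/-- `T` commutes with constants, so the defect `T (f s) - T_φ f · T s` is unchanged in form when `f`
is replaced by `f - c`. At a given point `c` can be taken to be the value of `f` there, where the
bound vanishes. -/
lemma IsDominatedBy.isKoopmanHom {φ : MeasureAut μ} {T : Γ →L[𝕜] Λ} {m : ℝ}
    (h : IsDominatedBy φ T m) : IsKoopmanHom φ T := by
  rw [isDominatedBy_iff] at h
  intro f s
  rw [← sub_eq_zero]
  refine eq_zero_of_vnorm_le_zero 𝕜 μ _ ?_
  have key : ∀ c : 𝕜, ∀ᵐ y ∂μ,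
      (vnorm 𝕜 (T (f • s) - φ.koopman f • T s) : Lp ℝ 1 μ) y ≤ ‖f (φ.invFun y) - c‖ *
        (m * (vnorm 𝕜 s : Lp ℝ 1 μ) (φ.invFun y) + (vnorm 𝕜 (T s) : Lp ℝ 1 μ) y) := by
    intro c
    have hdec : T (f • s) - φ.koopman f • T s
        = T ((f - constLinfty μ c) • s) + (constLinfty μ c - φ.koopman f) • T s := by
      rw [sub_smul, sub_smul, map_sub, constLinfty_smul, constLinfty_smul, T.map_smul c s]
      abel
    rw [hdec]
    filter_upwards [vnorm_add_le_ae 𝕜 μ (T ((f - constLinfty μ c) • s))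
        ((constLinfty μ c - φ.koopman f) • T s), h ((f - constLinfty μ c) • s),
      φ.ae_inv (vnorm_smul (𝕜 := 𝕜) (μ := μ) (f - constLinfty μ c) s),
      vnorm_smul (𝕜 := 𝕜) (μ := μ) (constLinfty μ c - φ.koopman f) (T s),
      φ.ae_inv (Lp.coeFn_sub f (constLinfty μ c)), Lp.coeFn_sub (constLinfty μ c) (φ.koopman f),
      φ.ae_inv (coeFn_constLinfty (μ := μ) c), coeFn_constLinfty (μ := μ) c,
      φ.coeFn_koopman f] with y h1 h2 h3 h4 h5 h6 h7 h8 h9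
    rw [h3, h5, Pi.sub_apply, h7] at h2
    rw [h4, h6, Pi.sub_apply, h8, h9, norm_sub_rev c] at h1
    linarith
  -- The constant needed depends on `y`, while the null set in `key` depends on the constant.
  -- Countably many dense constants share one null set, and the bound is continuous in `c`.
  have key' : ∀ᵐ y ∂μ, ∀ n : ℕ, _ := ae_all_iff.2 fun n => key (TopologicalSpace.denseSeq 𝕜 n)
  filter_upwards [key'] with y hy
  have hc := isClosed_property (TopologicalSpace.denseRange_denseSeq 𝕜)
    (p := fun c : 𝕜 => (vnorm 𝕜 (T (f • s) - φ.koopman f • T s) : Lp ℝ 1 μ) y ≤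
      ‖f (φ.invFun y) - c‖ *
        (m * (vnorm 𝕜 s : Lp ℝ 1 μ) (φ.invFun y) + (vnorm 𝕜 (T s) : Lp ℝ 1 μ) y))
    (isClosed_le continuous_const (by fun_prop)) hy (f (φ.invFun y))
  simpa using hc

variable (𝕜 μ) in
lemma norm_eq_integral_vnorm (s : Γ) : ‖s‖ = ∫ x, (vnorm 𝕜 s : Lp ℝ 1 μ) x ∂μ := by
  rw [← norm_vnorm (𝕜 := 𝕜) (μ := μ), L1.norm_eq_integral_norm]
  refine integral_congr_ae ?_
  filter_upwards [vnorm_nonneg_ae 𝕜 μ s] with x hx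
  exact Real.norm_of_nonneg hx

variable (𝕜) in
lemma norm_eq_integral_vnorm_comp (φ : MeasureAut μ) (s : Γ) :
    ‖s‖ = ∫ y, (vnorm 𝕜 s : Lp ℝ 1 μ) (φ.invFun y) ∂μ := by
  rw [← norm_vnorm (𝕜 := 𝕜) (μ := μ), ← φ.norm_koopman, L1.norm_eq_integral_norm]
  refine integral_congr_ae ?_
  filter_upwards [φ.ae_inv (vnorm_nonneg_ae 𝕜 μ s), φ.coeFn_koopman (vnorm 𝕜 s : Lp ℝ 1 μ)]
    with x hx h
  rw [h]
  exact Real.norm_of_nonneg hx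

variable (𝕜) in
lemma integrable_vnorm_comp (φ : MeasureAut μ) (s : Γ) :
    Integrable (fun y => (vnorm 𝕜 s : Lp ℝ 1 μ) (φ.invFun y)) μ :=
  φ.measurePreserving_inv.integrable_comp_of_integrable (L1.integrable_coeFn _)

/-- For `A` of finite measure, `f = 1_{φ⁻¹ A}` has `T_φ f = 1_A`. Hence `∫_A |T s| = ‖T (f s)‖ ≤ ‖T‖
‖f s‖ = ‖T‖ ∫_A |s| ∘ φ⁻¹`, and inequality of all such integrals is inequality almost everywhere. -/
lemma IsKoopmanHom.isDominatedBy {φ : MeasureAut μ} {T : Γ →L[𝕜] Λ} (hT : IsKoopmanHom φ T) :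
    IsDominatedBy φ T ‖T‖ := by
  rw [isDominatedBy_iff]
  intro s
  refine ae_le_of_forall_setIntegral_le (L1.integrable_coeFn _)
    ((integrable_vnorm_comp 𝕜 φ s).const_mul _) fun A hA hμA => ?_
  have hA' : MeasurableSet (φ.toFun ⁻¹' A) := φ.measurePreserving.measurable hA
  have hμA' : μ (φ.toFun ⁻¹' A) ≠ ∞ := by
    rw [φ.measurePreserving.measure_preimage hA.nullMeasurableSet]
    exact hμA.ne
  set f : Lp 𝕜 ∞ μ := indicatorConstLp ∞ hA' hμA' (1 : 𝕜) with hf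
  have hfA : ∀ᵐ y ∂μ, ‖f (φ.invFun y)‖ = A.indicator (fun _ => (1 : ℝ)) y := by
    filter_upwards [φ.ae_inv (indicatorConstLp_coeFn (p := ∞) (hs := hA') (hμs := hμA')
      (c := (1 : 𝕜))), φ.right_inv] with y h1 h2
    rw [hf, h1]
    by_cases hy : y ∈ A
    · rw [Set.indicator_of_mem hy, Set.indicator_of_mem (by rwa [Set.mem_preimage, h2]), norm_one]
    · rw [Set.indicator_of_notMem hy,
        Set.indicator_of_notMem (by rwa [Set.mem_preimage, h2]), norm_zero]
  have h1 : ∫ y in A, (vnorm 𝕜 (T s) : Lp ℝ 1 μ) y ∂μ = ‖T (f • s)‖ := by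
    rw [norm_eq_integral_vnorm 𝕜 μ, hT, ← integral_indicator hA]
    refine integral_congr_ae ?_
    filter_upwards [hfA, φ.coeFn_koopman f, vnorm_smul (𝕜 := 𝕜) (μ := μ) (φ.koopman f) (T s)]
      with y h1 h2 h3
    rw [h3, h2, h1]
    by_cases hy : y ∈ A <;> simp [hy]
  have h2 : ∫ y in A, (vnorm 𝕜 s : Lp ℝ 1 μ) (φ.invFun y) ∂μ = ‖f • s‖ := by
    rw [norm_eq_integral_vnorm_comp 𝕜 φ, ← integral_indicator hA]
    refine integral_congr_ae ?_
    filter_upwards [hfA, φ.ae_inv (vnorm_smul (𝕜 := 𝕜) (μ := μ) f s)] with y h1 h3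
    rw [h3, h1]
    by_cases hy : y ∈ A <;> simp [hy]
  rw [integral_const_mul, h1, h2]
  exact T.le_opNorm _

lemma isKoopmanHom_tfae (φ : MeasureAut μ) (T : Γ →L[𝕜] Λ) :
    List.TFAE [IsKoopmanHom φ T, IsDominatedBy φ T ‖T‖,
      ∃ m : ℝ, 0 < m ∧ IsDominatedBy φ T m] := by
  tfae_have 1 → 2 := IsKoopmanHom.isDominatedBy
  -- The constant must be positive, and `‖T‖` may vanish.
  tfae_have 2 → 3 := fun h => ⟨‖T‖ + 1, by positivity, h.mono (by linarith)⟩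
  tfae_have 3 → 1 := fun ⟨_, _, h⟩ => h.isKoopmanHom
  tfae_finish

/-- An isometric `T_φ`-homomorphism satisfies `|T s| = T_φ |s|`. -/
lemma IsKoopmanHom.vnorm_eq_of_isometry {φ : MeasureAut μ} {T : Γ →L[𝕜] Λ}
    (hT : IsKoopmanHom φ T) (hi : Isometry T) (s : Γ) :
    ∀ᵐ y ∂μ, (vnorm 𝕜 (T s) : Lp ℝ 1 μ) y = (vnorm 𝕜 s : Lp ℝ 1 μ) (φ.invFun y) := by
  have hn : ∀ s, ‖T s‖ = ‖s‖ := fun s => by simpa using hi.dist_eq s 0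
  -- Equality fails if the module is zero; the upper bound suffices.
  have h1 : ‖T‖ ≤ 1 := T.opNorm_le_bound zero_le_one fun s => by rw [hn, one_mul]
  have h2 := isDominatedBy_iff.1 (hT.isDominatedBy.mono h1) s
  simp only [one_mul] at h2
  -- Two integrable functions that are ordered almost everywhere and have equal integrals agree
  -- almost everywhere.
  refine (integral_eq_iff_of_ae_le (L1.integrable_coeFn _)
    (integrable_vnorm_comp 𝕜 φ s) h2).1 ?_
  rw [← norm_eq_integral_vnorm_comp, ← norm_eq_integral_vnorm, hn]

end Modules

/-! ### Bounded operators prescribed on a sequence with dense span. -/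

section SpanSequence

variable {𝕜 : Type v} [RCLike 𝕜]

/-- Initial segments replace supports so that, for fixed length, the coefficients range over the
separable space `Fin n → 𝕜`. Every large `n` is allowed so that two sequences can be summed over the
same segment. -/
lemma sum_range_eq_sum_fin {M : Type*} [AddCommGroup M] [Module 𝕜 M] (e : ℕ → M) (c : ℕ →₀ 𝕜) :
    ∃ N : ℕ, ∀ n ≥ N, Finsupp.linearCombination 𝕜 e c = ∑ i : Fin n, c i • e i := by
  obtain ⟨N, hN⟩ := c.support.exists_nat_subset_range
  refine ⟨N, fun n hn => ?_⟩
  rw [Finsupp.linearCombination_apply, Fin.sum_univ_eq_sum_range (fun i => c i • e i) n]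
  exact Finsupp.sum_of_support_subset _ (hN.trans (Finset.range_mono hn)) _ fun i _ => zero_smul _ _

lemma exists_sum_fin_of_mem_span {M : Type*} [AddCommGroup M] [Module 𝕜 M] {e : ℕ → M} {w : M}
    (hw : w ∈ Submodule.span 𝕜 (Set.range e)) :
    ∃ (N : ℕ) (a : Fin N → 𝕜), ∑ i, a i • e i = w := by
  obtain ⟨c, rfl⟩ := Finsupp.mem_span_range_iff_exists_finsupp.1 hw
  obtain ⟨N, hN⟩ := sum_range_eq_sum_fin e c
  exact ⟨N, fun i => c i, (hN N le_rfl).symm.trans (Finsupp.linearCombination_apply _ _)⟩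

/-- A map defined on a sequence with dense span and bounded on its linear combinations extends to
a bounded linear operator. -/
lemma exists_clm_of_norm_sum_le {V : Type*} [NormedAddCommGroup V] [NormedSpace 𝕜 V]
    {W : Type*} [NormedAddCommGroup W] [NormedSpace 𝕜 W] [CompleteSpace W]
    {e : ℕ → V} {f : ℕ → W} {m : ℝ} (hm : 0 ≤ m)
    (hd : Dense (Submodule.span 𝕜 (Set.range e) : Set V))
    (h : ∀ (N : ℕ) (a : Fin N → 𝕜), ‖∑ i, a i • f i‖ ≤ m * ‖∑ i, a i • e i‖) :
    ∃ L : V →L[𝕜] W, ‖L‖ ≤ m ∧ ∀ n, L (e n) = f n := by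
  have hdense : DenseRange (Finsupp.linearCombination 𝕜 e) := by
    rw [← Finsupp.range_linearCombination] at hd
    exact hd
  have hnorm : ∀ c : ℕ →₀ 𝕜,
      ‖Finsupp.linearCombination 𝕜 f c‖ ≤ m * ‖Finsupp.linearCombination 𝕜 e c‖ := by
    intro c
    obtain ⟨N, hN⟩ := sum_range_eq_sum_fin e c
    obtain ⟨N', hN'⟩ := sum_range_eq_sum_fin f c
    rw [hN _ (le_max_left N N'), hN' _ (le_max_right N N')]
    exact h _ _
  refine ⟨(Finsupp.linearCombination 𝕜 f).extendOfNorm (Finsupp.linearCombination 𝕜 e),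
    LinearMap.opNorm_extendOfNorm_le hdense hm hnorm, fun n => ?_⟩
  have := LinearMap.extendOfNorm_eq hdense ⟨m, hnorm⟩ (Finsupp.single n 1)
  simpa using this

end SpanSequence

/-! ### Integrable sections and fibrewise dense sequences. -/

namespace MeasurableBundle

variable {𝕜 : Type v} [RCLike 𝕜] {Ω : Type u} [MeasurableSpace Ω] {μ : Measure Ω}
  {E : Ω → Type w} [∀ x, NormedAddCommGroup (E x)] [∀ x, NormedSpace 𝕜 (E x)]
  (B : MeasurableBundle 𝕜 μ E)

lemma mk_mem_secSubmodule {p : ℝ≥0∞} (s : B.sections) :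
    (Submodule.Quotient.mk s : B.L0) ∈ B.secSubmodule p ↔ MemLp (fun x => ‖s.1 x‖) p μ := by
  change B.absVal _ ∈ Lp ℝ p μ ↔ _
  rw [Lp.mem_Lp_iff_memLp]
  exact memLp_congr_ae (B.absVal_mk s)

/-- The measurable sections representing elements of `Γ^1(E)`. -/
def integrableSections : Submodule 𝕜 B.sections :=
  (B.secSubmodule 1).comap B.null.mkQ

lemma mem_integrableSections (s : B.sections) :
    s ∈ B.integrableSections ↔ Integrable (fun x => ‖s.1 x‖) μ := by
  rw [← memLp_one_iff_integrable]
  exact B.mk_mem_secSubmodule s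

variable {B} in
lemma ae_secAbs_eq {p : ℝ≥0∞} {σ : B.Sec p} {s : B.sections}
    (h : σ.1 = Submodule.Quotient.mk s) : ∀ᵐ x ∂μ, B.secAbs σ x = ‖s.1 x‖ := by
  change ∀ᵐ x ∂μ, B.absVal σ.1 x = ‖s.1 x‖
  rw [h]
  exact B.absVal_mk s

/-- Every measurable section becomes integrable after multiplication by a positive function. -/
lemma exists_pos_smul_integrable [SigmaFinite μ] (s : B.sections) :
    ∃ g : Ω → ℝ, Measurable g ∧ (∀ x, 0 < g x) ∧
      ∃ u ∈ B.integrableSections, ∀ x, u.1 x = (g x : 𝕜) • s.1 x := by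
  obtain ⟨r, hr0, hrm, hri⟩ := exists_pos_lintegral_lt_of_sigmaFinite μ one_ne_zero
  have hsm := B.measurable_norm s.1 s.2
  -- Here `r` is a positive integrable function, which exists by σ-finiteness. The factor `r / (1 +
  -- |s|)` stays positive and makes the product bounded by `r`.
  have hgm : Measurable fun x => (r x : ℝ) / (1 + ‖s.1 x‖) :=
    hrm.coe_nnreal_real.div (measurable_const.add hsm)
  refine ⟨fun x => (r x : ℝ) / (1 + ‖s.1 x‖), hgm,
    fun x => div_pos (NNReal.coe_pos.2 (hr0 x)) (by positivity),
    ⟨_, B.smul_mem _ (RCLike.measurable_ofReal.comp hgm) s.1 s.2⟩, ?_, fun x => rfl⟩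
  rw [mem_integrableSections]
  have hri' : Integrable (fun x => (r x : ℝ)) μ := by
    refine ⟨hrm.coe_nnreal_real.aestronglyMeasurable, ?_⟩
    rw [HasFiniteIntegral]
    simpa using hri.trans ENNReal.one_lt_top
  refine hri'.mono' (B.measurable_norm _ (B.smul_mem _ (RCLike.measurable_ofReal.comp hgm)
    s.1 s.2)).aestronglyMeasurable (Eventually.of_forall fun x => ?_)
  rw [norm_norm]
  change ‖(((r x : ℝ) / (1 + ‖s.1 x‖) : ℝ) : 𝕜) • s.1 x‖ ≤ _
  have h1 : (0 : ℝ) < 1 + ‖s.1 x‖ := by positivity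
  rw [norm_smul, RCLike.norm_ofReal, abs_of_nonneg (by positivity), div_mul_eq_mul_div,
    div_le_iff₀ h1]
  exact mul_le_mul_of_nonneg_left (by linarith) (NNReal.coe_nonneg _)

/-- The sequence `s` spans a dense subspace in almost every fibre. -/
def IsFundamental (s : ℕ → B.sections) : Prop :=
  ∀ᵐ x ∂μ, Dense (Submodule.span 𝕜 (Set.range fun n => (s n).1 x) : Set (E x))

variable {B}

lemma IsSeparable.exists_integrable [SigmaFinite μ] (hB : B.IsSeparable) :
    ∃ s : ℕ → B.sections, (∀ n, s n ∈ B.integrableSections) ∧ B.IsFundamental s := by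
  obtain ⟨s, hs, hd⟩ := hB
  choose g _ hg u hu hgu using fun n => B.exists_pos_smul_integrable ⟨s n, hs n⟩
  refine ⟨u, hu, ?_⟩
  filter_upwards [hd] with x hx
  refine hx.mono (SetLike.coe_subset_coe.2 (Submodule.span_le.2 ?_))
  rintro _ ⟨n, rfl⟩
  have h : s n x = (g n x : 𝕜)⁻¹ • (u n).1 x := by
    rw [hgu, inv_smul_smul₀ (RCLike.ofReal_ne_zero.2 (hg n x).ne')]
  change s n x ∈ _
  rw [h]
  exact Submodule.smul_mem _ _ (Submodule.subset_span ⟨n, rfl⟩)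

lemma sum_smul_apply {N : ℕ} (s : ℕ → B.sections) (a : Fin N → 𝕜) (x : Ω) :
    (∑ i : Fin N, a i • s i : B.sections).1 x = ∑ i : Fin N, a i • (s i).1 x := by
  simp

/-- The span of a fundamental sequence contains countably many sections which are dense in almost
every fibre. -/
lemma IsFundamental.exists_denseRange {s : ℕ → B.sections} (hs : B.IsFundamental s) :
    ∃ d : ℕ × ℕ → B.sections, (∀ k, d k ∈ Submodule.span 𝕜 (Set.range s)) ∧
      ∀ᵐ x ∂μ, DenseRange fun k => (d k).1 x := by
  refine ⟨fun k => ∑ i : Fin k.1, TopologicalSpace.denseSeq (Fin k.1 → 𝕜) k.2 i • s i,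
    fun k => Submodule.sum_mem _ fun i _ => Submodule.smul_mem _ _ (Submodule.subset_span ⟨i, rfl⟩),
    ?_⟩
  filter_upwards [hs] with x hd v
  -- The coefficients in `𝕜` do not depend on `x`, so the same countable set of them serves every
  -- fibre. It remains to approximate the coefficients of an element of the span.
  refine closure_minimal ?_ isClosed_closure (hd v)
  intro w hw
  obtain ⟨N, a, rfl⟩ := exists_sum_fin_of_mem_span hw
  refine isClosed_property (TopologicalSpace.denseRange_denseSeq (Fin N → 𝕜))
    (p := fun a => ∑ i : Fin N, a i • (s i).1 x ∈ closure (Set.range _))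
    (isClosed_closure.preimage (f := fun a : Fin N → 𝕜 => ∑ i : Fin N, a i • (s i).1 x) (by fun_prop))
    (fun k => subset_closure ⟨(N, k), ?_⟩) a
  exact sum_smul_apply s _ x

/-- A closed condition on the fibres holds almost everywhere as soon as it does for all linear
combinations of a fundamental sequence. -/
lemma IsFundamental.ae_forall {s : ℕ → B.sections} (hs : B.IsFundamental s)
    {p : ∀ x, E x → Prop} (hp : ∀ᵐ x ∂μ, IsClosed {v | p x v})
    (h : ∀ u ∈ Submodule.span 𝕜 (Set.range s), ∀ᵐ x ∂μ, p x (u.1 x)) :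
    ∀ᵐ x ∂μ, ∀ v, p x v := by
  obtain ⟨d, hd, hdense⟩ := hs.exists_denseRange
  filter_upwards [hdense, hp, ae_all_iff.2 fun k => h (d k) (hd k)] with x hx hc hk v
  exact isClosed_property hx hc hk v

/-- Countably many integrable sections which are dense in almost every fibre. -/
lemma IsSeparable.exists_denseRange [SigmaFinite μ] (hB : B.IsSeparable) :
    ∃ d : ℕ × ℕ → B.sections, (∀ k, d k ∈ B.integrableSections) ∧
      ∀ᵐ x ∂μ, DenseRange fun k => (d k).1 x := by
  obtain ⟨s, hs, hf⟩ := hB.exists_integrable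
  obtain ⟨d, hd, hdense⟩ := hf.exists_denseRange
  refine ⟨d, fun k => Submodule.span_le.2 ?_ (hd k), hdense⟩
  rintro _ ⟨n, rfl⟩
  exact hs n

lemma IsSeparable.ae_forall [SigmaFinite μ] (hB : B.IsSeparable)
    {p : ∀ x, E x → Prop} (hp : ∀ᵐ x ∂μ, IsClosed {v | p x v})
    (h : ∀ u ∈ B.integrableSections, ∀ᵐ x ∂μ, p x (u.1 x)) :
    ∀ᵐ x ∂μ, ∀ v, p x v := by
  obtain ⟨d, hd, hdense⟩ := hB.exists_denseRange
  filter_upwards [hdense, hp, ae_all_iff.2 fun k => h (d k) (hd k)] with x hx hc hk v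
  exact isClosed_property hx hc hk v

end MeasurableBundle

/-! ### From dominated operators to bundle morphisms. -/

section Representation

variable {𝕜 : Type v} [RCLike 𝕜] {Ω : Type u} [MeasurableSpace Ω] {μ : Measure Ω}
  {E : Ω → Type w} [∀ x, NormedAddCommGroup (E x)] [∀ x, NormedSpace 𝕜 (E x)]
  {F : Ω → Type w'} [∀ x, NormedAddCommGroup (F x)] [∀ x, NormedSpace 𝕜 (F x)]
  {φ : MeasureAut μ} {B : MeasurableBundle 𝕜 μ E} {C : MeasurableBundle 𝕜 μ F}

lemma MeasureAut.ae_of_ae_comp (φ : MeasureAut μ) {P : Ω → Prop} (h : ∀ᵐ x ∂μ, P (φ.toFun x)) :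
    ∀ᵐ y ∂μ, P y := by
  filter_upwards [φ.ae_inv h, φ.right_inv] with y h1 h2
  rwa [h2] at h1

/-- Pairs `(u, t)` of measurable sections with `u` integrable and `T [u] = [t]`. -/
def sectionGraph (T : B.Sec 1 →L[𝕜] C.Sec 1) : Submodule 𝕜 (B.sections × C.sections) where
  carrier := {p | ∃ σ : B.Sec 1, σ.1 = Submodule.Quotient.mk p.1 ∧
    (T σ).1 = Submodule.Quotient.mk p.2}
  zero_mem' := ⟨0, rfl, by rw [map_zero]; rfl⟩
  add_mem' := by
    rintro p q ⟨σ, h1, h2⟩ ⟨τ, h3, h4⟩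
    refine ⟨σ + τ, ?_, ?_⟩
    · change σ.1 + τ.1 = _
      rw [h1, h3]
      rfl
    · rw [map_add]
      change (T σ).1 + (T τ).1 = _
      rw [h2, h4]
      rfl
  smul_mem' := by
    rintro c p ⟨σ, h1, h2⟩
    refine ⟨c • σ, ?_, ?_⟩
    · change c • σ.1 = _
      rw [h1]
      rfl
    · rw [T.map_smul]
      change c • (T σ).1 = _
      rw [h2]
      rfl

lemma exists_mem_sectionGraph (T : B.Sec 1 →L[𝕜] C.Sec 1) {u : B.sections}
    (hu : u ∈ B.integrableSections) : ∃ t : C.sections, (u, t) ∈ sectionGraph T := by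
  obtain ⟨t, ht⟩ := Submodule.Quotient.mk_surjective _ (T ⟨Submodule.Quotient.mk u, hu⟩).1
  exact ⟨t, _, rfl, ht.symm⟩

lemma IsDominatedBy.ae_norm_le {T : B.Sec 1 →L[𝕜] C.Sec 1} {m : ℝ} (h : IsDominatedBy φ T m)
    {p : B.sections × C.sections} (hp : p ∈ sectionGraph T) :
    ∀ᵐ x ∂μ, ‖p.2.1 (φ.toFun x)‖ ≤ m * ‖p.1.1 x‖ := by
  obtain ⟨σ, h1, h2⟩ := hp
  filter_upwards [φ.ae_comp (isDominatedBy_iff.1 h σ),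
    φ.ae_comp (MeasurableBundle.ae_secAbs_eq h2), MeasurableBundle.ae_secAbs_eq h1, φ.left_inv]
    with x h3 h4 h5 h6
  rw [h6] at h3
  rw [← h4, ← h5]
  exact h3

/-- A dominated operator is given by bounded operators between the fibres. -/
lemma IsDominatedBy.exists_fiber_maps [SigmaFinite μ] [∀ x, CompleteSpace (F x)]
    (hB : B.IsSeparable) {T : B.Sec 1 →L[𝕜] C.Sec 1} {m : ℝ} (hm : 0 ≤ m)
    (h : IsDominatedBy φ T m) :
    ∃ L : ∀ x, E x →L[𝕜] F (φ.toFun x), (∀ x, ‖L x‖ ≤ m) ∧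
      ∀ p ∈ sectionGraph T, ∀ᵐ x ∂μ, L x (p.1.1 x) = p.2.1 (φ.toFun x) := by
  obtain ⟨s, hs, hf⟩ := hB.exists_integrable
  choose t ht using fun n => exists_mem_sectionGraph T (hs n)
  have hsum : ∀ (N : ℕ) (a : Fin N → 𝕜),
      (∑ i : Fin N, a i • s i, ∑ i : Fin N, a i • t i) ∈ sectionGraph T := by
    intro N a
    have := (sectionGraph T).sum_mem (t := Finset.univ) (f := fun i : Fin N => a i • (s i, t i))
      fun i _ => Submodule.smul_mem _ _ (ht i)
    convert this using 1
    refine Prod.ext ?_ ?_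
    · rw [Prod.fst_sum]
      rfl
    · rw [Prod.snd_sum]
      rfl
  have hbound : ∀ᵐ x ∂μ, ∀ (N : ℕ) (a : Fin N → 𝕜),
      ‖∑ i, a i • (t i).1 (φ.toFun x)‖ ≤ m * ‖∑ i, a i • (s i).1 x‖ := by
    -- Domination is applied to countably many linear combinations only; continuity in the
    -- coefficients gives all of them off the same null set.
    have : ∀ᵐ x ∂μ, ∀ (N k : ℕ), _ := ae_all_iff.2 fun N => ae_all_iff.2 fun k =>
      h.ae_norm_le (hsum N (TopologicalSpace.denseSeq (Fin N → 𝕜) k))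
    filter_upwards [this] with x hx N a
    refine isClosed_property (TopologicalSpace.denseRange_denseSeq (Fin N → 𝕜))
      (p := fun a => ‖∑ i : Fin N, a i • (t i).1 (φ.toFun x)‖ ≤
        m * ‖∑ i : Fin N, a i • (s i).1 x‖)
      (isClosed_le (by fun_prop) (by fun_prop)) (fun k => ?_) a
    have := hx N k
    rwa [MeasurableBundle.sum_smul_apply, MeasurableBundle.sum_smul_apply] at this
  have hex : ∀ x, ∃ L : E x →L[𝕜] F (φ.toFun x), ‖L‖ ≤ m ∧
      (Dense (Submodule.span 𝕜 (Set.range fun n => (s n).1 x) : Set (E x)) →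
        (∀ (N : ℕ) (a : Fin N → 𝕜),
          ‖∑ i, a i • (t i).1 (φ.toFun x)‖ ≤ m * ‖∑ i, a i • (s i).1 x‖) →
        ∀ n, L ((s n).1 x) = (t n).1 (φ.toFun x)) := by
    intro x
    by_cases hx : Dense (Submodule.span 𝕜 (Set.range fun n => (s n).1 x) : Set (E x)) ∧
      ∀ (N : ℕ) (a : Fin N → 𝕜),
        ‖∑ i, a i • (t i).1 (φ.toFun x)‖ ≤ m * ‖∑ i, a i • (s i).1 x‖
    · obtain ⟨L, h1, h2⟩ := exists_clm_of_norm_sum_le hm hx.1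
        (f := fun n => (t n).1 (φ.toFun x)) hx.2
      exact ⟨L, h1, fun _ _ => h2⟩
    -- The zero operator on exceptional fibres keeps the bound `m` valid at every point.
    · exact ⟨0, by rwa [norm_zero], fun h1 h2 => absurd ⟨h1, h2⟩ hx⟩
  choose L hLm hL using hex
  have hLs : ∀ᵐ x ∂μ, ∀ n, L x ((s n).1 x) = (t n).1 (φ.toFun x) := by
    filter_upwards [hf, hbound] with x h1 h2
    exact hL x h1 h2
  refine ⟨L, hLm, fun p hp => ?_⟩
  -- An arbitrary pair is compared with the combinations of the chosen pairs: domination bounds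
  -- their difference. The estimate is closed in `v`, so it extends to all `v`, and `v = u(x)` makes
  -- the right side zero.
  have hall : ∀ᵐ x ∂μ, ∀ v, ‖p.2.1 (φ.toFun x) - L x v‖ ≤ m * ‖p.1.1 x - v‖ := by
    refine hf.ae_forall (Eventually.of_forall fun x => isClosed_le (by fun_prop) (by fun_prop))
      fun u hu => ?_
    obtain ⟨N, a, rfl⟩ := exists_sum_fin_of_mem_span hu
    filter_upwards [hLs, h.ae_norm_le ((sectionGraph T).sub_mem hp (hsum N a))] with x h1 h2
    have h3 : L x ((∑ i : Fin N, a i • s i : B.sections).1 x) =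
        (∑ i : Fin N, a i • t i : C.sections).1 (φ.toFun x) := by
      rw [MeasurableBundle.sum_smul_apply, MeasurableBundle.sum_smul_apply, map_sum]
      simp_rw [map_smul, h1]
    rw [h3]
    exact h2
  filter_upwards [hall] with x hx
  have := hx (p.1.1 x)
  rw [sub_self, norm_zero, mul_zero] at this
  exact (sub_eq_zero.1 (norm_le_zero_iff.1 this)).symm

namespace Premorphism

/-- The premorphism given by a uniformly bounded family of operators between the fibres. -/
def ofFiberMaps (L : ∀ x, E x →L[𝕜] F (φ.toFun x)) {m : ℝ} (hL : ∀ x, ‖L x‖ ≤ m)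
    (h : ∀ s ∈ B.sections, ∃ t ∈ C.sections, ∀ᵐ x ∂μ, L x (s x) = t (φ.toFun x)) :
    Premorphism φ B C where
  toFun z := ⟨φ.toFun z.1, L z.1 z.2⟩
  map_sections s hs := by
    obtain ⟨t, ht, h'⟩ := h s hs
    refine ⟨t, ht, ?_⟩
    filter_upwards [h'] with x hx
    rw [hx]
  fiber_linear := Eventually.of_forall fun x => ⟨L x, fun _ => rfl⟩
  bounded := by
    refine lt_of_le_of_lt (essSup_le_of_ae_le (ENNReal.ofReal m) (Eventually.of_forall fun x => ?_))
      ENNReal.ofReal_lt_top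
    refine iSup₂_le fun v hv => ?_
    change ‖L x v‖ₑ ≤ _
    rw [← ofReal_norm]
    exact ENNReal.ofReal_le_ofReal (((L x).unit_le_opNorm v hv).trans (hL x))

/-- Stated at `x` instead of `y = φ x`, the relation lives in the fibre over `φ x`, where `Φ`
restricts to an operator on `E x`. No identification of `φ (φ⁻¹ y)` with `y` is then needed. -/
lemma koopmanL0_mk_eq_mk_iff_comp (Φ : Premorphism φ B C) (s : B.sections) (t : C.sections) :
    Φ.koopmanL0 (Submodule.Quotient.mk s) = Submodule.Quotient.mk t ↔
      ∀ᵐ x ∂μ, Φ.toFun ⟨x, s.1 x⟩ = ⟨φ.toFun x, t.1 (φ.toFun x)⟩ := by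
  rw [koopmanL0_mk_eq_mk_iff]
  constructor
  · intro h
    filter_upwards [φ.ae_comp h, φ.left_inv] with x h1 h2
    rwa [h2] at h1
  · intro h
    filter_upwards [φ.ae_inv h, φ.right_inv] with x h1 h2
    rwa [h2] at h1

end Premorphism

lemma IsDominatedBy.exists_premorphism [SigmaFinite μ] [∀ x, CompleteSpace (F x)]
    (hB : B.IsSeparable) {T : B.Sec 1 →L[𝕜] C.Sec 1} {m : ℝ} (hm : 0 ≤ m)
    (h : IsDominatedBy φ T m) : ∃ Φ : Premorphism φ B C, T = Φ.koopman 1 := by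
  obtain ⟨L, hLm, hL⟩ := h.exists_fiber_maps hB hm
  refine ⟨Premorphism.ofFiberMaps L hLm fun s hs => ?_, ?_⟩
  · obtain ⟨g, hgm, hg, u, hu, hgu⟩ := B.exists_pos_smul_integrable ⟨s, hs⟩
    obtain ⟨t, ht⟩ := exists_mem_sectionGraph T hu
    -- Since `s = g⁻¹ u` with `u` integrable and `T [u] = [t]`, the image section must be `(g⁻¹ ∘
    -- φ⁻¹) t`.
    refine ⟨_, C.smul_mem (fun y => ((g (φ.invFun y))⁻¹ : ℝ))
      (RCLike.measurable_ofReal.comp (hgm.comp φ.measurePreserving_inv.measurable).inv) t.1 t.2, ?_⟩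
    filter_upwards [hL _ ht, φ.left_inv] with x h1 h2
    rw [h2, ← h1, hgu, map_smul, RCLike.ofReal_inv,
      inv_smul_smul₀ (RCLike.ofReal_ne_zero.2 (hg x).ne')]
  · refine ContinuousLinearMap.ext ?_
    rintro ⟨q, hq⟩
    obtain ⟨u, rfl⟩ := Submodule.Quotient.mk_surjective _ q
    obtain ⟨t, σ, h1, h2⟩ := exists_mem_sectionGraph T (u := u) hq
    obtain rfl : σ = ⟨_, hq⟩ := Subtype.ext h1
    refine Subtype.ext (h2.trans (Eq.symm ?_))
    refine (Premorphism.koopmanL0_mk_eq_mk_iff_comp _ u t).2 ?_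
    filter_upwards [hL (u, t) ⟨_, h1, h2⟩] with x hx
    exact congrArg (Sigma.mk (φ.toFun x)) hx

end Representation

/-! ### Fibre norms, the supremum formula, isometries and uniqueness. -/

namespace Premorphism

variable {𝕜 : Type v} [RCLike 𝕜] {Ω : Type u} [MeasurableSpace Ω] {μ : Measure Ω}
  {E : Ω → Type w} [∀ x, NormedAddCommGroup (E x)] [∀ x, NormedSpace 𝕜 (E x)]
  {F : Ω → Type w'} [∀ x, NormedAddCommGroup (F x)] [∀ x, NormedSpace 𝕜 (F x)]
  {φ : MeasureAut μ} {B : MeasurableBundle 𝕜 μ E} {C : MeasurableBundle 𝕜 μ F}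

lemma norm_nonneg (Φ : Premorphism φ B C) : 0 ≤ Φ.norm := ENNReal.toReal_nonneg

lemma norm_toFun_eq {Φ : Premorphism φ B C} {x : Ω} {L : E x →L[𝕜] F (φ.toFun x)}
    (hL : ∀ v : E x, Φ.toFun ⟨x, v⟩ = ⟨φ.toFun x, L v⟩) (v : E x) :
    ‖(Φ.toFun ⟨x, v⟩).2‖ = ‖L v‖ := by
  rw [hL]

lemma fiberNorm_eq {Φ : Premorphism φ B C} {x : Ω} {L : E x →L[𝕜] F (φ.toFun x)}
    (hL : ∀ v : E x, Φ.toFun ⟨x, v⟩ = ⟨φ.toFun x, L v⟩) :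
    fiberNorm Φ.toFun x = ENNReal.ofReal ‖L‖ := by
  have he : fiberNorm Φ.toFun x = ⨆ (v : E x) (_ : ‖v‖ ≤ 1), ‖L v‖ₑ :=
    iSup_congr fun v => iSup_congr fun _ => by rw [hL]
  have hle : fiberNorm Φ.toFun x ≤ ENNReal.ofReal ‖L‖ := by
    rw [he]
    refine iSup₂_le fun v hv => ?_
    rw [← ofReal_norm]
    exact ENNReal.ofReal_le_ofReal (L.unit_le_opNorm v hv)
  refine le_antisymm hle (ENNReal.ofReal_le_of_le_toReal ?_)
  refine L.opNorm_le_bound ENNReal.toReal_nonneg fun v => ?_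
  by_cases hv : v = 0
  · simp [hv]
  have h1 := norm_smul_inv_norm (𝕜 := 𝕜) hv
  have h2 : ‖L (((‖v‖ : 𝕜)⁻¹) • v)‖ₑ ≤ fiberNorm Φ.toFun x := by
    rw [he]
    exact le_iSup₂ (f := fun (v : E x) (_ : ‖v‖ ≤ 1) => ‖L v‖ₑ) _ h1.le
  have h3 := ENNReal.toReal_mono (hle.trans_lt ENNReal.ofReal_lt_top).ne h2
  rwa [toReal_enorm, map_smul, norm_smul, norm_inv, RCLike.norm_ofReal, abs_norm,
    inv_mul_le_iff₀ (norm_pos_iff.2 hv), mul_comm] at h3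

lemma ae_continuous_norm (Φ : Premorphism φ B C) :
    ∀ᵐ x ∂μ, Continuous fun v : E x => ‖(Φ.toFun ⟨x, v⟩).2‖ := by
  filter_upwards [Φ.fiber_linear] with x ⟨L, hL⟩
  simp_rw [norm_toFun_eq hL]
  fun_prop

lemma ae_norm_le (Φ : Premorphism φ B C) : ∀ᵐ x ∂μ, ∀ v : E x,
    ‖(Φ.toFun ⟨x, v⟩).2‖ ≤ (fiberNorm Φ.toFun x).toReal * ‖v‖ := by
  filter_upwards [Φ.fiber_linear] with x ⟨L, hL⟩ v
  rw [norm_toFun_eq hL, fiberNorm_eq hL, ENNReal.toReal_ofReal (_root_.norm_nonneg _)]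
  exact L.le_opNorm v

lemma ae_fiberNorm_le_ofReal_norm (Φ : Premorphism φ B C) :
    ∀ᵐ x ∂μ, fiberNorm Φ.toFun x ≤ ENNReal.ofReal Φ.norm := by
  rw [norm, ENNReal.ofReal_toReal Φ.bounded.ne]
  exact ENNReal.ae_le_essSup _

lemma norm_le_of_ae_fiberNorm_le {Φ : Premorphism φ B C} {c : ℝ} (hc : 0 ≤ c)
    (h : ∀ᵐ x ∂μ, fiberNorm Φ.toFun x ≤ ENNReal.ofReal c) : Φ.norm ≤ c :=
  ENNReal.toReal_le_of_le_ofReal hc (essSup_le_of_ae_le _ h)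

/-- Common source of the norm formulas: the inequality is closed in each fibre, so bounds along
individual sections, each with its own null set, already bound the operator norm. No measurability
of `c` is required. -/
lemma ae_fiberNorm_le [SigmaFinite μ] (hB : B.IsSeparable) {Φ : Premorphism φ B C} {c : Ω → ℝ}
    (h0 : ∀ᵐ x ∂μ, 0 ≤ c x)
    (h : ∀ u ∈ B.integrableSections, ∀ᵐ x ∂μ, ‖(Φ.toFun ⟨x, u.1 x⟩).2‖ ≤ c x * ‖u.1 x‖) :
    ∀ᵐ x ∂μ, fiberNorm Φ.toFun x ≤ ENNReal.ofReal (c x) := by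
  have hall := hB.ae_forall (p := fun x v => ‖(Φ.toFun ⟨x, v⟩).2‖ ≤ c x * ‖v‖)
    (Φ.ae_continuous_norm.mono fun x hx => isClosed_le hx (by fun_prop)) h
  filter_upwards [hall, h0, Φ.fiber_linear] with x h1 h2 ⟨L, hL⟩
  rw [fiberNorm_eq hL]
  refine ENNReal.ofReal_le_ofReal (L.opNorm_le_bound h2 fun v => ?_)
  rw [← norm_toFun_eq hL]
  exact h1 v

lemma ae_secAbs_koopman (Φ : Premorphism φ B C) {p : ℝ≥0∞} [Fact (1 ≤ p)] {σ : B.Sec p}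
    {u : B.sections} (h : σ.1 = Submodule.Quotient.mk u) :
    ∀ᵐ x ∂μ, C.secAbs (Φ.koopman p σ) (φ.toFun x) = ‖(Φ.toFun ⟨x, u.1 x⟩).2‖ := by
  obtain ⟨t, ht⟩ := Submodule.Quotient.mk_surjective _ (Φ.koopman p σ).1
  have h' : Φ.koopmanL0 (Submodule.Quotient.mk u) = Submodule.Quotient.mk t := by
    rw [ht, ← h]
    rfl
  filter_upwards [(Φ.koopmanL0_mk_eq_mk_iff_comp u t).1 h',
    φ.ae_comp (MeasurableBundle.ae_secAbs_eq ht.symm)] with x h1 h2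
  rw [h1, h2]

lemma isDominatedBy_norm (Φ : Premorphism φ B C) : IsDominatedBy φ (Φ.koopman 1) Φ.norm :=
  isDominatedBy_iff.2 fun s => Φ.absVal_koopmanL0_le s.1

lemma norm_koopman_le (Φ : Premorphism φ B C) (p : ℝ≥0∞) [Fact (1 ≤ p)] :
    ‖Φ.koopman p‖ ≤ Φ.norm :=
  LinearMap.mkContinuous_norm_le _ Φ.norm_nonneg _

/-- Domination improves itself: being dominated by some constant makes `𝒯_Φ` a homomorphism, hence
dominated by its own operator norm, which then bounds the fibre norms. -/
lemma norm_eq_norm_koopman_one [SigmaFinite μ] (hB : B.IsSeparable) (Φ : Premorphism φ B C) :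
    Φ.norm = ‖Φ.koopman 1‖ := by
  refine le_antisymm (norm_le_of_ae_fiberNorm_le (_root_.norm_nonneg _) ?_) (Φ.norm_koopman_le 1)
  have hdom := Φ.isDominatedBy_norm.isKoopmanHom.isDominatedBy
  refine ae_fiberNorm_le hB (Eventually.of_forall fun _ => _root_.norm_nonneg _) fun u hu => ?_
  let σ : B.Sec 1 := ⟨Submodule.Quotient.mk u, hu⟩
  filter_upwards [φ.ae_comp (isDominatedBy_iff.1 hdom σ), Φ.ae_secAbs_koopman (σ := σ) rfl,
    MeasurableBundle.ae_secAbs_eq (σ := σ) rfl, φ.left_inv] with x h1 h2 h3 h4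
  rw [h4] at h1
  rw [← h2, ← h3]
  exact h1

lemma secAbs_le_one_iff {s : B.Sec ∞} {u : B.sections}
    (h : s.1 = Submodule.Quotient.mk u) : B.secAbs s ≤ 1 ↔ ∀ᵐ x ∂μ, ‖u.1 x‖ ≤ 1 := by
  rw [← Lp.coeFn_le]
  refine eventually_congr ?_
  filter_upwards [MeasurableBundle.ae_secAbs_eq h, coeFn_Linfty_one (𝕜 := ℝ) (μ := μ)] with x h1 h2
  rw [h1, h2]

/-- The fibre norms of `Φ` are determined by the values of `𝒯_Φ` on the unit ball of
`Γ^∞(E)`. -/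
lemma ae_fiberNorm_le_of_unit [SigmaFinite μ] (hB : B.IsSeparable) {Φ : Premorphism φ B C}
    {c : Ω → ℝ} (h : ∀ s : B.Sec ∞, B.secAbs s ≤ 1 →
      ∀ᵐ x ∂μ, C.secAbs (Φ.koopman ∞ s) (φ.toFun x) ≤ c x) :
    ∀ᵐ x ∂μ, fiberNorm Φ.toFun x ≤ ENNReal.ofReal (c x) := by
  have hu : ∀ u : B.sections, (∀ x, ‖u.1 x‖ ≤ 1) →
      ∀ᵐ x ∂μ, ‖(Φ.toFun ⟨x, u.1 x⟩).2‖ ≤ c x := by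
    intro u hu
    let σ : B.Sec ∞ := ⟨Submodule.Quotient.mk u, (B.mk_mem_secSubmodule u).2
      (memLp_top_of_bound (B.aestronglyMeasurable_norm u) 1
        (Eventually.of_forall fun x => (norm_norm (u.1 x)).le.trans (hu x)))⟩
    filter_upwards [h σ ((secAbs_le_one_iff rfl).2 (Eventually.of_forall hu)),
      Φ.ae_secAbs_koopman (σ := σ) rfl] with x h1 h2
    rwa [← h2]
  refine ae_fiberNorm_le hB ?_ fun u _ => ?_
  -- Testing on the zero section shows `c ≥ 0`.
  · filter_upwards [hu 0 fun x => by simp] with x hx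
    exact (_root_.norm_nonneg _).trans hx
  -- The section `u / |u|` has norm at most one; the convention `0⁻¹ = 0` makes it vanish where `u`
  -- does.
  · have hm : Measurable fun x => ((‖u.1 x‖⁻¹ : ℝ) : 𝕜) :=
      RCLike.measurable_ofReal.comp (B.measurable_norm u.1 u.2).inv
    have h1 := hu ⟨_, B.smul_mem _ hm u.1 u.2⟩ fun x => by
      change ‖((‖u.1 x‖⁻¹ : ℝ) : 𝕜) • u.1 x‖ ≤ 1
      rw [norm_smul, RCLike.norm_ofReal, abs_of_nonneg (by positivity)]
      exact inv_mul_le_one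
    filter_upwards [h1, Φ.fiber_linear] with x h1 ⟨L, hL⟩
    rw [norm_toFun_eq hL] at h1 ⊢
    by_cases hx : u.1 x = 0
    · simp [hx]
    rwa [map_smul, norm_smul, RCLike.norm_ofReal, abs_of_nonneg (by positivity),
      inv_mul_le_iff₀ (norm_pos_iff.2 hx), mul_comm] at h1

lemma norm_eq_norm_koopman_top [SigmaFinite μ] (hB : B.IsSeparable) (Φ : Premorphism φ B C) :
    Φ.norm = ‖Φ.koopman ∞‖ := by
  refine le_antisymm (norm_le_of_ae_fiberNorm_le (_root_.norm_nonneg _) ?_) (Φ.norm_koopman_le ∞)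
  refine ae_fiberNorm_le_of_unit hB fun s hs =>
    φ.ae_comp (P := fun y => C.secAbs (Φ.koopman ∞ s) y ≤ _) ?_
  have h1 : ‖s‖ ≤ 1 := by
    rw [MeasurableBundle.norm_sec_def]
    obtain ⟨u, hu⟩ := Submodule.Quotient.mk_surjective _ s.1
    rw [Lp.norm_def, eLpNorm_exponent_top]
    refine ENNReal.toReal_le_of_le_ofReal zero_le_one (eLpNormEssSup_le_of_ae_bound ?_)
    filter_upwards [MeasurableBundle.ae_secAbs_eq hu.symm,
      (secAbs_le_one_iff hu.symm).1 hs] with x h1 h2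
    rwa [h1, norm_norm]
  filter_upwards [ae_norm_le_Linfty (C.secAbs (Φ.koopman ∞ s))] with y hy
  refine (le_abs_self _).trans (hy.trans ?_)
  refine ((Φ.koopman ∞).le_opNorm s).trans ?_
  exact mul_le_of_le_one_right (_root_.norm_nonneg _) h1

/-- The operator norm is the supremum of `‖L v‖ / ‖v‖` over a dense set of `v`, and countably many
sections supply one in almost every fibre. Where a section vanishes the quotient is `0` and does not
affect the supremum. -/
lemma aemeasurable_fiberNorm [SigmaFinite μ] (hB : B.IsSeparable) (Φ : Premorphism φ B C) :
    AEMeasurable (fiberNorm Φ.toFun) μ := by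
  obtain ⟨d, -, hd⟩ := hB.exists_denseRange
  choose t ht hdt using fun k => Φ.map_sections (d k).1 (d k).2
  refine ⟨fun x => ⨆ k, ENNReal.ofReal (‖t k (φ.toFun x)‖ / ‖(d k).1 x‖), ?_, ?_⟩
  · exact Measurable.iSup fun k => (((C.measurable_norm _ (ht k)).comp
      φ.measurePreserving.measurable).div (B.measurable_norm _ (d k).2)).ennreal_ofReal
  filter_upwards [hd, ae_all_iff.2 hdt, Φ.fiber_linear] with x h1 h2 ⟨L, hL⟩
  have h3 : ∀ k, ‖t k (φ.toFun x)‖ = ‖L ((d k).1 x)‖ := fun k => by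
    rw [← norm_toFun_eq hL, h2]
  simp_rw [h3]
  rw [fiberNorm_eq hL]
  have hle : ⨆ k, ENNReal.ofReal (‖L ((d k).1 x)‖ / ‖(d k).1 x‖) ≤ ENNReal.ofReal ‖L‖ :=
    iSup_le fun k => ENNReal.ofReal_le_ofReal (L.ratio_le_opNorm _)
  refine le_antisymm (ENNReal.ofReal_le_of_le_toReal ?_) hle
  refine L.opNorm_le_bound ENNReal.toReal_nonneg fun v => ?_
  refine isClosed_property h1 (p := fun v => ‖L v‖ ≤ _ * ‖v‖)
    (isClosed_le (by fun_prop) (by fun_prop)) (fun k => ?_) v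
  by_cases hk : (d k).1 x = 0
  · simp [hk]
  rw [← div_le_iff₀ (norm_pos_iff.2 hk), ← ENNReal.ofReal_le_iff_le_toReal
    (hle.trans_lt ENNReal.ofReal_lt_top).ne]
  exact le_iSup (fun k => ENNReal.ofReal (‖L ((d k).1 x)‖ / ‖(d k).1 x‖)) k

lemma memLp_top_fiberNorm [SigmaFinite μ] (hB : B.IsSeparable) (Φ : Premorphism φ B C) :
    MemLp (fun x => (fiberNorm Φ.toFun x).toReal) ∞ μ := by
  refine memLp_top_of_bound (Φ.aemeasurable_fiberNorm hB).ennreal_toReal.aestronglyMeasurable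
    Φ.norm ?_
  filter_upwards [Φ.ae_fiberNorm_le_ofReal_norm] with x hx
  rw [Real.norm_of_nonneg ENNReal.toReal_nonneg]
  exact ENNReal.toReal_le_of_le_ofReal Φ.norm_nonneg hx

lemma isLUB_secAbs_koopman [SigmaFinite μ] (hB : B.IsSeparable) (Φ : Premorphism φ B C)
    {g : Lp ℝ ∞ μ} (hg : ∀ᵐ x ∂μ, g x = (fiberNorm Φ.toFun x).toReal) :
    IsLUB {h : Lp ℝ ∞ μ | ∃ s : B.Sec ∞, B.secAbs s ≤ 1 ∧ h = C.secAbs (Φ.koopman ∞ s)}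
      (φ.koopman g) := by
  have hcomp : ∀ᵐ x ∂μ, φ.koopman g (φ.toFun x) = g x := by
    filter_upwards [φ.ae_comp (φ.coeFn_koopman g), φ.left_inv] with x h1 h2
    rw [h1, h2]
  constructor
  · rintro _ ⟨s, hs, rfl⟩
    obtain ⟨u, hu⟩ := Submodule.Quotient.mk_surjective _ s.1
    rw [← Lp.coeFn_le]
    refine φ.ae_of_ae_comp ?_
    filter_upwards [hcomp, hg, Φ.ae_secAbs_koopman hu.symm, Φ.ae_norm_le,
      (secAbs_le_one_iff hu.symm).1 hs] with x h1 h2 h3 h4 h5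
    rw [h1, h2, h3]
    exact (h4 _).trans (mul_le_of_le_one_right ENNReal.toReal_nonneg h5)
  · intro h hh
    have hle : ∀ s : B.Sec ∞, B.secAbs s ≤ 1 →
        ∀ᵐ x ∂μ, C.secAbs (Φ.koopman ∞ s) (φ.toFun x) ≤ h (φ.toFun x) :=
      fun s hs => φ.ae_comp ((Lp.coeFn_le _ _).2 (hh ⟨s, hs, rfl⟩))
    -- Passing from `ENNReal.ofReal` back to real values needs `h ≥ 0`, which holds because `h`
    -- bounds the image of the zero section.
    have h0 : ∀ᵐ x ∂μ, 0 ≤ h (φ.toFun x) := by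
      filter_upwards [hle 0 ((secAbs_le_one_iff (u := 0) rfl).2
        (Eventually.of_forall fun x => by simp)),
        φ.ae_comp (C.absVal_nonneg (Φ.koopman ∞ 0).1)] with x h1 h2
      exact h2.trans h1
    rw [← Lp.coeFn_le]
    refine φ.ae_of_ae_comp ?_
    filter_upwards [hcomp, hg, ae_fiberNorm_le_of_unit hB hle, h0] with x h1 h2 h3 h4
    rw [h1, h2]
    exact ENNReal.toReal_le_of_le_ofReal h4 h3

/-- Fibrewise isometry integrates to equality of norms. Conversely, an isometric homomorphism
preserves `|s|` pointwise by `IsKoopmanHom.vnorm_eq_of_isometry`, and equality of norms is a closed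
condition in each fibre. -/
lemma isIsometric_iff [SigmaFinite μ] (hB : B.IsSeparable) (Φ : Premorphism φ B C) :
    Φ.IsIsometric ↔ Isometry (Φ.koopman 1) := by
  constructor
  · intro h
    refine AddMonoidHomClass.isometry_of_norm _ fun s => ?_
    rw [norm_eq_integral_vnorm 𝕜 μ, norm_eq_integral_vnorm_comp 𝕜 φ]
    refine integral_congr_ae (φ.ae_of_ae_comp ?_)
    obtain ⟨u, hu⟩ := Submodule.Quotient.mk_surjective _ s.1
    filter_upwards [Φ.ae_secAbs_koopman hu.symm, MeasurableBundle.ae_secAbs_eq hu.symm,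
      φ.left_inv, h] with x h1 h2 h3 h4
    rw [h3]
    exact h1.trans ((h4 _).trans h2.symm)
  · intro h
    refine hB.ae_forall (p := fun x v => ‖(Φ.toFun ⟨x, v⟩).2‖ = ‖v‖)
      (Φ.ae_continuous_norm.mono fun x hx => isClosed_eq hx continuous_norm) fun u hu => ?_
    let σ : B.Sec 1 := ⟨Submodule.Quotient.mk u, hu⟩
    filter_upwards [Φ.ae_secAbs_koopman (σ := σ) rfl, MeasurableBundle.ae_secAbs_eq (σ := σ) rfl,
      φ.ae_comp (Φ.isDominatedBy_norm.isKoopmanHom.vnorm_eq_of_isometry h σ), φ.left_inv]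
      with x h1 h2 h3 h4
    rw [h4] at h3
    exact h1.symm.trans (h3.trans h2)

lemma ae_eq_of_koopman_one_eq [SigmaFinite μ] (hB : B.IsSeparable) {Φ Ψ : Premorphism φ B C}
    (h : Φ.koopman 1 = Ψ.koopman 1) : Φ ≈ Ψ := by
  refine hB.ae_forall (p := fun x v => Φ.toFun ⟨x, v⟩ = Ψ.toFun ⟨x, v⟩) ?_ fun u hu => ?_
  -- Both values lie over the same point `φ x`, so equality in the total space is equality of two
  -- continuous maps into one fibre.
  · filter_upwards [Φ.fiber_linear, Ψ.fiber_linear] with x ⟨L, hL⟩ ⟨L', hL'⟩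
    simp_rw [hL, hL', sigma_mk_injective.eq_iff]
    exact isClosed_eq L.continuous L'.continuous
  · obtain ⟨t, ht⟩ := Submodule.Quotient.mk_surjective _ (Φ.koopmanL0 (Submodule.Quotient.mk u))
    have h' : Ψ.koopmanL0 (Submodule.Quotient.mk u) = Submodule.Quotient.mk t := by
      rw [ht]
      exact (congrArg Subtype.val (DFunLike.congr_fun h ⟨Submodule.Quotient.mk u, hu⟩)).symm
    filter_upwards [(Φ.koopmanL0_mk_eq_mk_iff_comp u t).1 ht.symm,
      (Ψ.koopmanL0_mk_eq_mk_iff_comp u t).1 h'] with x h1 h2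
    rw [h1, h2]

end Premorphism

end MeasBundle

end

theorem mainTheorem4 {𝕜 : Type*} [RCLike 𝕜] {Ω : Type*} [MeasurableSpace Ω]
    (μ : MeasureTheory.Measure Ω) [MeasureTheory.SigmaFinite μ] [μ.IsComplete]
    (φ : MeasBundle.MeasureAut μ) :
    -- operators between general `L^1(X)`-normed modules
    (∀ (Γ : Type*) [NormedAddCommGroup Γ] [NormedSpace 𝕜 Γ] [CompleteSpace Γ]
        [MeasBundle.L1NormedModule 𝕜 μ Γ]
        (Λ : Type*) [NormedAddCommGroup Λ] [NormedSpace 𝕜 Λ] [CompleteSpace Λ]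
        [MeasBundle.L1NormedModule 𝕜 μ Λ] (T : Γ →L[𝕜] Λ),
      List.TFAE
        [MeasBundle.IsKoopmanHom φ T,
          MeasBundle.IsDominatedBy φ T ‖T‖,
          ∃ m : ℝ, 0 < m ∧ MeasBundle.IsDominatedBy φ T m]) ∧
    -- operators between modules of integrable sections
    (∀ (E : Ω → Type*) [∀ x, NormedAddCommGroup (E x)] [∀ x, NormedSpace 𝕜 (E x)]
        [∀ x, CompleteSpace (E x)]
        (F : Ω → Type*) [∀ x, NormedAddCommGroup (F x)] [∀ x, NormedSpace 𝕜 (F x)]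
        [∀ x, CompleteSpace (F x)]
        (B : MeasBundle.MeasurableBundle 𝕜 μ E) (C : MeasBundle.MeasurableBundle 𝕜 μ F),
      B.IsSeparable →
        (∀ T : B.Sec 1 →L[𝕜] C.Sec 1,
          List.TFAE
            [MeasBundle.IsKoopmanHom φ T,
              MeasBundle.IsDominatedBy φ T ‖T‖,
              ∃ m : ℝ, 0 < m ∧ MeasBundle.IsDominatedBy φ T m,
              ∃ Φ : MeasBundle.Morphism φ B C, T = Φ.koopman 1]) ∧
        (∀ T : B.Sec 1 →L[𝕜] C.Sec 1,
          (∃ Φ : MeasBundle.Morphism φ B C, T = Φ.koopman 1) →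
            ∃! Φ : MeasBundle.Morphism φ B C, T = Φ.koopman 1) ∧
        (∀ Φ : MeasBundle.Morphism φ B C,
          (∃ g : MeasureTheory.Lp ℝ ⊤ μ,
            (∀ Ψ : MeasBundle.Premorphism φ B C, Φ.IsRepresentedBy Ψ →
              ∀ᵐ x ∂μ, g x = (MeasBundle.fiberNorm Ψ.toFun x).toReal) ∧
            IsLUB {h : MeasureTheory.Lp ℝ ⊤ μ |
                ∃ s : B.Sec ⊤, B.secAbs s ≤ 1 ∧ h = C.secAbs (Φ.koopman ⊤ s)}
              (φ.koopman g)) ∧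
          Φ.norm = ‖Φ.koopman ⊤‖ ∧
          Φ.norm = ‖Φ.koopman 1‖ ∧
          (Φ.IsIsometric ↔ Isometry (Φ.koopman 1)))) := by
  refine ⟨fun Γ _ _ _ _ Λ _ _ _ _ T => MeasBundle.isKoopmanHom_tfae φ T, ?_⟩
  intro E _ _ _ F _ _ _ B C hB
  refine ⟨fun T => ?_, ?_, fun Φ => ?_⟩
  · have h := MeasBundle.isKoopmanHom_tfae φ T
    tfae_have 1 ↔ 2 := h.out 0 1
    tfae_have 2 ↔ 3 := h.out 1 2
    tfae_have 3 → 4 := by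
      rintro ⟨m, hm, hT⟩
      obtain ⟨Φ, hΦ⟩ := hT.exists_premorphism hB hm.le
      exact ⟨Quotient.mk _ Φ, hΦ⟩
    tfae_have 4 → 1 := by
      rintro ⟨Φ, rfl⟩
      induction Φ using Quotient.inductionOn with
      | _ Φ => exact Φ.isDominatedBy_norm.isKoopmanHom
    tfae_finish
  · rintro T ⟨Φ, rfl⟩
    refine ⟨Φ, rfl, fun Ψ h => ?_⟩
    induction Φ using Quotient.inductionOn with
    | _ Φ =>
      induction Ψ using Quotient.inductionOn with
      | _ Ψ => exact Quotient.sound (MeasBundle.Premorphism.ae_eq_of_koopman_one_eq hB h.symm)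
  · induction Φ using Quotient.inductionOn with
    | _ Φ =>
      -- The class `|Φ|` is built from one representative; any other has almost everywhere the same
      -- fibre norms.
      have hg := (Φ.memLp_top_fiberNorm hB).coeFn_toLp
      refine ⟨⟨(Φ.memLp_top_fiberNorm hB).toLp _, fun Ψ hΨ => ?_, Φ.isLUB_secAbs_koopman hB hg⟩,
        Φ.norm_eq_norm_koopman_top hB, Φ.norm_eq_norm_koopman_one hB, Φ.isIsometric_iff hB⟩
      filter_upwards [hg, MeasBundle.Premorphism.fiberNorm_congr (Quotient.exact hΨ)] with x h1 h2
      rw [h1, h2]
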